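/- Let $\Omega\subset\mathbb{R}^N$ be a bounded open set, $T>0$, $Q=(0,T)\times\Omega$, $1<p<\infty$ and $p'=\frac{p}{p-1}$. Let $V=W_0^{1,p}(\Omega)\cap L^2(\Omega)$, with norm $\|v\|_V=\|v\|_{W_0^{1,p}(\Omega)}+\|v\|_{L^2(\Omega)}$ and dual $V'$, and let $$W=\{u\in L^p(0,T;V): u_t\in L^{p'}(0,T;V')\},\qquad \|u\|_W=\|u\|_{L^p(0,T;V)}+\|u_t\|_{L^{p'}(0,T;V')},$$ where $u_t$ is the distributional derivative, $V$ being embedded in $V'$ through the scalar product of $L^2(\Omega)$. For an open set $U\subset Q$ let $$\mathrm{cap}_p(U)=\inf\{\|u\|_W : u\in W,\ u\ge\chi_U \text{ a.e. in } Q\}$$ (with $\inf\emptyset=+\infty$), and for a Borel set $B\subset Q$ let $\mathrm{cap}_p(B)=\inf\{\mathrm{cap}_p(U): B\subset U\subset Q,\ U \text{ open}\}$. A finite (signed) Radon measure $\mu$ in $Q$ is called diffuse if $\mu(E)=0$ for every Borel set $E\subset Q$ with $\mathrm{cap}_p(E)=0$. Let $(\rho_n)_{n\ge1}$ be a sequence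 of mollifiers: $\rho_n\in C_c^\infty(\mathbb{R}^{N+1})$, $\operatorname{supp}\rho_n\subset B_{1/n}(0)$, $\rho_n\ge0$ and $\int_{\mathbb{R}^{N+1}}\rho_n=1$. Put $$(\rho_n*\mu)(t,x)=\int_Q\rho_n(t-s,x-y)\,d\mu(s,y),$$ and identify this function with the measure $(\rho_n*\mu)\,dt\,dx$ in $Q$. If $\mu$ is diffuse, then the sequence $(\rho_n*\mu)$ is equidiffuse: for every $\varepsilon>0$ there exists $\eta>0$ such that, for every Borel set $E\subset Q$, $$\mathrm{cap}_p(E)<\eta\ \Longrightarrow\ |\rho_n*\mu|(E)<\varepsilon\quad\text{for all } n\ge1.$$ -/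

import Mathlib

open MeasureTheory Set
open scoped ENNReal ContDiff

noncomputable section

namespace ParabolicCapacity

/-- The space variable lives in `ℝ^N` with its Euclidean norm. -/
abbrev Space (N : ℕ) : Type := EuclideanSpace ℝ (Fin N)

/-- Space-time `ℝ × ℝ^N`, points written `(t, x)`; its `volume` is the `(N+1)`-dimensional
Lebesgue measure. -/
abbrev SpaceTime (N : ℕ) : Type := ℝ × Space N

/-- The cylinder `Q = (0, T) × Ω`. -/
def cylinder {N : ℕ} (Ω : Set (Space N)) (T : ℝ) : Set (SpaceTime N) := Ioo 0 T ×ˢ Ω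

section SobolevSpaces

variable {N : ℕ} (Ω : Set (Space N)) (p : ℝ≥0∞) [Fact (1 ≤ p)]

/-- Pairs (function, vector field) in `L^p(Ω) × L^p(Ω; ℝ^N)`, with norm
`‖v‖_{L^p} + ‖G‖_{L^p}`. -/
abbrev FieldPair : Type :=
  WithLp 1 (Lp ℝ p (volume.restrict Ω) × Lp (Space N) p (volume.restrict Ω))

/-- The pairs `(φ, ∇φ)` with `φ ∈ C_c^∞(Ω)`. -/
def testPairs : Submodule ℝ (FieldPair Ω p) where
  carrier := {w | ∃ φ : Space N → ℝ, ContDiff ℝ ∞ φ ∧ HasCompactSupport φ ∧ tsupport φ ⊆ Ω ∧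
    w.fst =ᵐ[volume.restrict Ω] φ ∧ w.snd =ᵐ[volume.restrict Ω] gradient φ}
  zero_mem' := by
    refine ⟨0, contDiff_const, HasCompactSupport.zero, by simp, Lp.coeFn_zero _ _ _, ?_⟩
    have : gradient (0 : Space N → ℝ) = 0 := by
      funext x
      exact gradient_const x 0
    rw [this]
    exact Lp.coeFn_zero _ _ _
  add_mem' := by
    rintro v w ⟨φ, h1, h2, h3, h4, h5⟩ ⟨ψ, k1, k2, k3, k4, k5⟩
    refine ⟨φ + ψ, h1.add k1, h2.add k2, (tsupport_add φ ψ).trans (union_subset h3 k3), ?_, ?_⟩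
    · exact (Lp.coeFn_add v.fst w.fst).trans (h4.add k4)
    · refine (Lp.coeFn_add v.snd w.snd).trans ((h5.add k5).trans (Filter.Eventually.of_forall ?_))
      intro x
      have hf : DifferentiableAt ℝ φ x := (h1.differentiable (by simp)).differentiableAt
      have hg : DifferentiableAt ℝ ψ x := (k1.differentiable (by simp)).differentiableAt
      simp [gradient, fderiv_add hf hg]
  smul_mem' := by
    rintro c w ⟨φ, h1, h2, h3, h4, h5⟩
    refine ⟨c • φ, contDiff_const.smul h1, h2.smul_left (f := fun _ => c),
      (closure_mono (Function.support_const_smul_subset c φ)).trans h3, ?_, ?_⟩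
    · exact (Lp.coeFn_smul c w.fst).trans (h4.const_smul c)
    · refine (Lp.coeFn_smul c w.snd).trans ((h5.const_smul c).trans
        (Filter.Eventually.of_forall ?_))
      intro x
      have hf : DifferentiableAt ℝ φ x := (h1.differentiable (by simp)).differentiableAt
      simp [gradient, fderiv_const_smul hf c]

/-- `W_0^{1,p}(Ω)`: the closure of `C_c^∞(Ω)` for `‖v‖_{L^p} + ‖∇v‖_{L^p}`; an element is a
function together with its weak gradient. -/
def W01p : Submodule ℝ (FieldPair Ω p) := (testPairs Ω p).topologicalClosure

/-- `V = W_0^{1,p}(Ω) ∩ L²(Ω)`, as the pairs in `W_0^{1,p}(Ω) × L²(Ω)` whose two entries are the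
same function, with norm `‖v‖_{W_0^{1,p}} + ‖v‖_{L²}`. -/
def sobolevV : Submodule ℝ (WithLp 1 (W01p Ω p × Lp ℝ 2 (volume.restrict Ω))) where
  carrier := {w | w.fst.1.fst =ᵐ[volume.restrict Ω] w.snd}
  zero_mem' := (Lp.coeFn_zero _ _ _).trans (Lp.coeFn_zero _ _ _).symm
  add_mem' := by
    intro v w (hv : v.fst.1.fst =ᵐ[volume.restrict Ω] v.snd)
      (hw : w.fst.1.fst =ᵐ[volume.restrict Ω] w.snd)
    exact (Lp.coeFn_add v.fst.1.fst w.fst.1.fst).trans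
      ((hv.add hw).trans (Lp.coeFn_add v.snd w.snd).symm)
  smul_mem' := by
    intro c w (hw : w.fst.1.fst =ᵐ[volume.restrict Ω] w.snd)
    exact (Lp.coeFn_smul c w.fst.1.fst).trans
      ((hw.const_smul c).trans (Lp.coeFn_smul c w.snd).symm)

/-- The space `V`, a normed space. -/
def V : Type := sobolevV Ω p

instance : NormedAddCommGroup (V Ω p) := inferInstanceAs (NormedAddCommGroup (sobolevV Ω p))

instance : NormedSpace ℝ (V Ω p) := inferInstanceAs (NormedSpace ℝ (sobolevV Ω p))

/-- The dual space `V'` with the operator norm. -/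
abbrev VDual : Type := V Ω p →L[ℝ] ℝ

/-- The inclusion `V ⊂ L²(Ω)`. -/
def toL2 : V Ω p →L[ℝ] Lp ℝ 2 (volume.restrict Ω) :=
  (WithLp.sndL 1 ℝ (W01p Ω p) (Lp ℝ 2 (volume.restrict Ω))).comp (sobolevV Ω p).subtypeL

/-- The inclusion `V ⊂ V'` through the pivot space `L²(Ω)`: `⟨u, v⟩ = ∫_Ω u v dx`. -/
def toDual (u : V Ω p) : VDual Ω p := (innerSL ℝ (toL2 Ω p u)).comp (toL2 Ω p)

/-- `F = u_t` in the sense of `V'`-valued distributions on `(0, T)`. -/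
def IsTimeDerivative (T : ℝ) (u : ℝ → V Ω p) (F : ℝ → VDual Ω p) : Prop :=
  ∀ φ : ℝ → ℝ, ContDiff ℝ ∞ φ → HasCompactSupport φ → tsupport φ ⊆ Ioo 0 T →
    ∫ t in Ioo 0 T, deriv φ t • toDual Ω p (u t) = -∫ t in Ioo 0 T, φ t • F t

/-- `u ∈ W`, with `u_t = F`: `u ∈ L^p(0,T;V)` and `u_t ∈ L^{p'}(0,T;V')`. -/
structure MemW (T : ℝ) (u : ℝ → V Ω p) (F : ℝ → VDual Ω p) : Prop where
  memLp : MemLp u p (volume.restrict (Ioo 0 T))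
  memLp_deriv : MemLp F (ENNReal.conjExponent p) (volume.restrict (Ioo 0 T))
  isTimeDerivative : IsTimeDerivative Ω p T u F

/-- `‖u‖_W = ‖u‖_{L^p(0,T;V)} + ‖u_t‖_{L^{p'}(0,T;V')}`, where `F = u_t`. -/
def normW (T : ℝ) (u : ℝ → V Ω p) (F : ℝ → VDual Ω p) : ℝ≥0∞ :=
  eLpNorm u p (volume.restrict (Ioo 0 T)) +
    eLpNorm F (ENNReal.conjExponent p) (volume.restrict (Ioo 0 T))

/-- `u ≥ χ_U` a.e. in `Q`: for a.e. `t ∈ (0,T)`, `u(t)(x) ≥ χ_U(t,x)` for a.e. `x ∈ Ω`. -/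
def DominatesIndicator (T : ℝ) (U : Set (SpaceTime N)) (u : ℝ → V Ω p) : Prop :=
  ∀ᵐ t ∂(volume.restrict (Ioo 0 T)), ∀ᵐ x ∂(volume.restrict Ω),
    U.indicator (fun _ => (1 : ℝ)) (t, x) ≤ toL2 Ω p (u t) x

/-- The parabolic `p`-capacity of an open set `U ⊆ Q` (it is `∞` if there is no competitor). -/
def capOpen (T : ℝ) (U : Set (SpaceTime N)) : ℝ≥0∞ :=
  ⨅ (u : ℝ → V Ω p) (F : ℝ → VDual Ω p) (_ : MemW Ω p T u F)
    (_ : DominatesIndicator Ω p T U u), normW Ω p T u F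

/-- The parabolic `p`-capacity of a Borel set `B ⊆ Q`: the infimum of the capacities of the open
sets `U` with `B ⊆ U ⊆ Q`. -/
def cap (T : ℝ) (B : Set (SpaceTime N)) : ℝ≥0∞ :=
  ⨅ (U : Set (SpaceTime N)) (_ : IsOpen U) (_ : B ⊆ U) (_ : U ⊆ cylinder Ω T), capOpen Ω p T U

/-- `μ ∈ M_0(Q)`: `μ` is a finite signed Borel (hence Radon) measure in `Q`, regarded as a measure
on `ℝ × ℝ^N` carried by `Q`, and it vanishes on every Borel set `E ⊆ Q` of zero capacity. -/
structure IsDiffuse (T : ℝ) (μ : SignedMeasure (SpaceTime N)) : Prop where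
  carried : μ.totalVariation (cylinder Ω T)ᶜ = 0
  null : ∀ E : Set (SpaceTime N), MeasurableSet E → E ⊆ cylinder Ω T → cap Ω p T E = 0 → μ E = 0

/-- The sequence `(ν_n)_{n ≥ 1}` of measures in `Q` is equidiffuse. -/
def IsEquidiffuse (T : ℝ) (ν : ℕ → SignedMeasure (SpaceTime N)) : Prop :=
  ∀ ε : ℝ, 0 < ε → ∃ η : ℝ, 0 < η ∧
    ∀ E : Set (SpaceTime N), MeasurableSet E → E ⊆ cylinder Ω T →
      cap Ω p T E < ENNReal.ofReal η →
        ∀ n : ℕ, 1 ≤ n → (ν n).totalVariation E < ENNReal.ofReal ε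

end SobolevSpaces

section Mollification

variable {N : ℕ}

/-- `(ρ_n)_{n ≥ 1}` is a sequence of mollifiers on `ℝ^{N+1}`: smooth, compactly supported in the
open Euclidean ball of radius `1/n` about the origin, nonnegative, of integral one. -/
structure IsMollifierSeq (ρ : ℕ → SpaceTime N → ℝ) : Prop where
  smooth : ∀ n, 1 ≤ n → ContDiff ℝ ∞ (ρ n)
  compactSupport : ∀ n, 1 ≤ n → HasCompactSupport (ρ n)
  support_subset : ∀ n, 1 ≤ n →
    tsupport (ρ n) ⊆ {z : SpaceTime N | Real.sqrt (z.1 ^ 2 + ‖z.2‖ ^ 2) < 1 / (n : ℝ)}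
  nonneg : ∀ n, 1 ≤ n → ∀ z, 0 ≤ ρ n z
  integral_eq_one : ∀ n, 1 ≤ n → ∫ z, ρ n z = 1

/-- `(ρ * μ)(t, x) = ∫_Q ρ(t - s, x - y) dμ(s, y)`, the integral against the signed measure `μ`
being the difference of the integrals against its positive and negative parts. -/
def conv (Ω : Set (Space N)) (T : ℝ) (ρ : SpaceTime N → ℝ) (μ : SignedMeasure (SpaceTime N))
    (z : SpaceTime N) : ℝ :=
  (∫ w in cylinder Ω T, ρ (z - w) ∂μ.toJordanDecomposition.posPart) -
    ∫ w in cylinder Ω T, ρ (z - w) ∂μ.toJordanDecomposition.negPart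

/-- The function `ρ * μ` regarded as a measure in `Q`, that is `E ↦ ∫_{E ∩ Q} ρ * μ dt dx`. -/
def convMeasure (Ω : Set (Space N)) (T : ℝ) (ρ : SpaceTime N → ℝ)
    (μ : SignedMeasure (SpaceTime N)) : SignedMeasure (SpaceTime N) :=
  (volume.restrict (cylinder Ω T)).withDensityᵥ (conv Ω T ρ μ)

/-- The density `ρ * μ` is integrable on `Q`, so `convMeasure` has the intended value. -/
theorem integrable_conv {Ω : Set (Space N)} (hΩ : Bornology.IsBounded Ω) (T : ℝ)
    {ρ : SpaceTime N → ℝ} (hρ : Continuous ρ) (hc : HasCompactSupport ρ)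
    (μ : SignedMeasure (SpaceTime N)) :
    Integrable (conv Ω T ρ μ) (volume.restrict (cylinder Ω T)) := by
  obtain ⟨C, hC⟩ := hρ.bounded_above_of_compact_support hc
  have hfin : IsFiniteMeasure (volume.restrict (cylinder Ω T)) := by
    refine ⟨?_⟩
    rw [Measure.restrict_apply_univ]
    exact ((Metric.isBounded_Ioo 0 T).prod hΩ).measure_lt_top
  have key : ∀ (m : Measure (SpaceTime N)) [IsFiniteMeasure m],
      Integrable (fun z => ∫ w, ρ (z - w) ∂m) (volume.restrict (cylinder Ω T)) := by
    intro m _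
    have hm : StronglyMeasurable (fun q : SpaceTime N × SpaceTime N => ρ (q.1 - q.2)) :=
      (hρ.comp (continuous_fst.sub continuous_snd)).stronglyMeasurable
    refine Integrable.of_bound hm.integral_prod_right.aestronglyMeasurable (C * m.real univ) ?_
    exact Filter.Eventually.of_forall fun z =>
      norm_integral_le_of_norm_le_const (Filter.Eventually.of_forall fun w => hC _)
  exact (key _).sub (key _)

end Mollification

end ParabolicCapacity

end

open MeasureTheory Set
open scoped ENNReal ContDiff

noncomputable section

/-! By Tonelli, $|\rho_n*\mu|(E)\le\int\rho_n(y)\,|\mu|(E-y)\,dy$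
(`totalVariation_convMeasure_le_translates`). For large $n$ it therefore suffices that $|\mu|(U-y)$
be small, uniformly in small $y$, whenever $U$ is open with small capacity. This is
`exists_translate_measure_lt`, and it rests on two facts.

Absolute continuity in $\varepsilon$-$\eta$ form (`exists_forall_capOpen_lt_measure_lt`): if it
failed, there would be open sets $U_n$ of capacity below $2^{-n}$ with $|\mu|(U_n)\ge\varepsilon$.
Their limsup would have capacity zero by countable subadditivity (`capOpen_iUnion_le`), yet measure
at least $\varepsilon$.

Localized translation (`exists_capOpen_translate_le`): a compact $K\subset Q$ carries $|\mu|$ up to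
$\varepsilon/2$. Take cutoffs $\alpha(t)$, $\beta(x)$ exceeding $1$ on the projections of $K$. If
$u$ competes for $U$, then $\alpha(t)\beta(x)u(t+\sigma,x+z)$ competes for the part of
$U-(\sigma,z)$ where $\alpha,\beta>1$, and its norm in $W$ is at most $C\|u\|_W$. Its time
derivative contains $\alpha'\beta u$, which must lie in $L^{p'}(0,T;V')$. For $p<2$ this does not
follow from $u\in L^p(0,T;V)$, since $p'>p$; it follows from $W\subset L^\infty(0,T;V')$
(`exists_ae_norm_le_of_weakDeriv`).

For the finitely many remaining $n$ the densities $\rho_n*\mu$ are bounded, and Lebesgue measure is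
at most a multiple of the capacity (`exists_volume_le_normW`). -/

namespace ParabolicCapacity

/-! ### Translations with a weight on $L^q$ spaces. -/

section WeightedShift

/-- An almost everywhere property on `S` holds at `x + z` for almost every `x` with `x + z ∈ S`. -/
theorem ae_shift {X : Type*} [AddGroup X] [MeasurableSpace X] [MeasurableAdd X] {μ : Measure X}
    [μ.IsAddRightInvariant] {S : Set X} (hS : MeasurableSet S) {P : X → Prop}
    (h : ∀ᵐ x ∂(μ.restrict S), P x) (z : X) : ∀ᵐ x ∂μ, x + z ∈ S → P (x + z) :=
  (measurePreserving_add_right μ z).quasiMeasurePreserving.ae ((ae_restrict_iff' hS).1 h)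

/-- The weight vanishes wherever the shifted point leaves `S`, so `f` may be extended by zero and
translation invariance used on the whole space. Operator-valued weights cover multiplication by
$\gamma$, by $\nabla\gamma$, and by $\alpha(t)M$ in time. -/
theorem weightedShift_eq {X E E' : Type*} [Add X] [NormedAddCommGroup E] [NormedSpace ℝ E]
    [NormedAddCommGroup E'] [NormedSpace ℝ E'] {S : Set X} {z : X} {g : X → E →L[ℝ] E'}
    (hs : ∀ x, g x ≠ 0 → x + z ∈ S) (f : X → E) (x : X) :
    g x (f (x + z)) = g x (S.indicator f (x + z)) := by
  by_cases hx : g x = 0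
  · simp [hx]
  · rw [indicator_of_mem (hs x hx)]

variable {X E E' : Type*} [NormedAddCommGroup X] [MeasurableSpace X] [BorelSpace X]
  {μ : Measure X} [μ.IsAddRightInvariant]
  [NormedAddCommGroup E] [NormedSpace ℝ E] [NormedAddCommGroup E'] [NormedSpace ℝ E']

theorem eLpNorm_weightedShift_le {S S' : Set X} (hS : MeasurableSet S) {z : X}
    {g : X → E →L[ℝ] E'} {C : ℝ} (hC : ∀ x, ‖g x‖ ≤ C)
    (hs : ∀ x, g x ≠ 0 → x + z ∈ S) {f : X → E} (hf : AEStronglyMeasurable f (μ.restrict S))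
    (q : ℝ≥0∞) :
    eLpNorm (fun x => g x (f (x + z))) q (μ.restrict S') ≤
      ENNReal.ofReal C * eLpNorm f q (μ.restrict S) := by
  refine (eLpNorm_mono_measure _ Measure.restrict_le_self).trans ?_
  simp_rw [weightedShift_eq hs f]
  have h0 : AEStronglyMeasurable (S.indicator f) μ := (aestronglyMeasurable_indicator_iff hS).2 hf
  refine (eLpNorm_le_mul_eLpNorm_of_ae_le_mul (g := fun x => S.indicator f (x + z))
    (Filter.Eventually.of_forall fun x => (g x).le_of_opNorm_le (hC x) _) q).trans ?_
  have := eLpNorm_comp_measurePreserving (p := q) h0 (measurePreserving_add_right μ z)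
  rw [← eLpNorm_indicator_eq_eLpNorm_restrict hS, ← this]
  rfl

variable [SecondCountableTopology X]

theorem aestronglyMeasurable_weightedShift {S : Set X} (hS : MeasurableSet S) {z : X}
    {g : X → E →L[ℝ] E'} (hg : Continuous g) (hs : ∀ x, g x ≠ 0 → x + z ∈ S) {f : X → E}
    (hf : AEStronglyMeasurable f (μ.restrict S)) :
    AEStronglyMeasurable (fun x => g x (f (x + z))) μ := by
  simp_rw [weightedShift_eq hs f]
  have h1 : AEStronglyMeasurable (fun x => S.indicator f (x + z)) μ :=
    ((aestronglyMeasurable_indicator_iff hS).2 hf).comp_measurePreserving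
      (measurePreserving_add_right μ z)
  exact (isBoundedBilinearMap_apply (𝕜 := ℝ) (E := E) (F := E')).continuous.comp_aestronglyMeasurable
    (hg.aestronglyMeasurable.prodMk h1)

theorem memLp_weightedShift {S S' : Set X} (hS : MeasurableSet S) {z : X}
    {g : X → E →L[ℝ] E'} (hg : Continuous g) {C : ℝ} (hC : ∀ x, ‖g x‖ ≤ C)
    (hs : ∀ x, g x ≠ 0 → x + z ∈ S) {f : X → E} {q : ℝ≥0∞} (hf : MemLp f q (μ.restrict S)) :
    MemLp (fun x => g x (f (x + z))) q (μ.restrict S') :=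
  ⟨(aestronglyMeasurable_weightedShift hS hg hs hf.1).restrict,
    (eLpNorm_weightedShift_le hS hC hs hf.1 q).trans_lt
      (ENNReal.mul_lt_top ENNReal.ofReal_lt_top hf.2)⟩

/-- The continuous linear map `f ↦ (x ↦ g x (f (x + z)))` between `L^q` spaces. -/
theorem exists_weightedShift {S : Set X} (hS : MeasurableSet S) {z : X}
    {g : X → E →L[ℝ] E'} (hg : Continuous g) {C : ℝ} (hC0 : 0 ≤ C) (hC : ∀ x, ‖g x‖ ≤ C)
    (hs : ∀ x, g x ≠ 0 → x + z ∈ S) (q : ℝ≥0∞) [Fact (1 ≤ q)] :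
    ∃ A : Lp E q (μ.restrict S) →L[ℝ] Lp E' q (μ.restrict S),
      (∀ f, ‖A f‖ ≤ C * ‖f‖) ∧ ∀ f, A f =ᵐ[μ.restrict S] fun x => g x (f (x + z)) := by
  have hm : ∀ f : Lp E q (μ.restrict S), MemLp (fun x => g x (f (x + z))) q (μ.restrict S) :=
    fun f => memLp_weightedShift hS hg hC hs (Lp.memLp f)
  have key : ∀ {P : X → Prop}, (∀ᵐ x ∂(μ.restrict S), P x) →
      ∀ᵐ x ∂(μ.restrict S), g x ≠ 0 → P (x + z) := fun h =>
    ae_restrict_of_ae ((ae_shift hS h z).mono fun x hx hne => hx (hs x hne))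
  let L : Lp E q (μ.restrict S) →ₗ[ℝ] Lp E' q (μ.restrict S) :=
    { toFun := fun f => (hm f).toLp _
      map_add' := fun f₁ f₂ => by
        rw [← MemLp.toLp_add]
        refine MemLp.toLp_congr _ _ ((key (Lp.coeFn_add f₁ f₂)).mono fun x hx => ?_)
        by_cases h : g x = 0
        · simp [h]
        · have h' := hx h
          rw [Pi.add_apply] at h'
          change g x (_ : E) = g x _ + g x _
          rw [h', map_add]
      map_smul' := fun c f => by
        rw [RingHom.id_apply, ← MemLp.toLp_const_smul]
        refine MemLp.toLp_congr _ _ ((key (Lp.coeFn_smul c f)).mono fun x hx => ?_)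
        by_cases h : g x = 0
        · simp [h]
        · simp [hx h] }
  have hL : ∀ f, ‖L f‖ ≤ C * ‖f‖ := fun f => by
    change ‖(hm f).toLp _‖ ≤ _
    rw [Lp.norm_toLp, Lp.norm_def]
    refine (ENNReal.toReal_mono (ENNReal.mul_ne_top ENNReal.ofReal_ne_top (Lp.memLp f).2.ne)
      (eLpNorm_weightedShift_le hS hC hs (Lp.memLp f).1 q)).trans ?_
    rw [ENNReal.toReal_mul, ENNReal.toReal_ofReal hC0]
  exact ⟨L.mkContinuous C hL, hL, fun f => (hm f).coeFn_toLp⟩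

end WeightedShift

/-! ### Cutoff and translation in space, acting on $W_0^{1,p}(\Omega)$ and $V$. -/

section SobolevOperators

variable {N : ℕ} (Ω : Set (Space N)) (p : ℝ≥0∞) [Fact (1 ≤ p)]

/-- The function and its weak gradient underlying an element of `V`. -/
def V.pair : V Ω p →L[ℝ] FieldPair Ω p :=
  (W01p Ω p).subtypeL.comp
    ((WithLp.fstL 1 ℝ (W01p Ω p) (Lp ℝ 2 (volume.restrict Ω))).comp (sobolevV Ω p).subtypeL)

variable {Ω p}

/-- The element of `V` given by an element of `W_0^{1,p}(Ω)` that lies in `L²(Ω)`. -/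
def V.mk (w : FieldPair Ω p) (hw : w ∈ W01p Ω p) (f : Lp ℝ 2 (volume.restrict Ω))
    (h : w.fst =ᵐ[volume.restrict Ω] f) : V Ω p :=
  (⟨WithLp.toLp 1 (⟨w, hw⟩, f), h⟩ : sobolevV Ω p)

@[simp]
theorem V.pair_mk (w : FieldPair Ω p) (hw : w ∈ W01p Ω p) (f : Lp ℝ 2 (volume.restrict Ω))
    (h : w.fst =ᵐ[volume.restrict Ω] f) : V.pair Ω p (V.mk w hw f h) = w := rfl

@[simp]
theorem V.toL2_mk (w : FieldPair Ω p) (hw : w ∈ W01p Ω p) (f : Lp ℝ 2 (volume.restrict Ω))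
    (h : w.fst =ᵐ[volume.restrict Ω] f) : toL2 Ω p (V.mk w hw f h) = f := rfl

theorem V.pair_mem (v : V Ω p) : V.pair Ω p v ∈ W01p Ω p :=
  (WithLp.fst (Subtype.val (p := (· ∈ sobolevV Ω p)) v)).2

theorem V.pair_fst_ae (v : V Ω p) : (V.pair Ω p v).fst =ᵐ[volume.restrict Ω] toL2 Ω p v :=
  Subtype.prop (p := (· ∈ sobolevV Ω p)) v

theorem V.ext_pair {v w : V Ω p} (h1 : V.pair Ω p v = V.pair Ω p w)
    (h2 : toL2 Ω p v = toL2 Ω p w) : v = w :=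
  Subtype.ext (p := (· ∈ sobolevV Ω p))
    (WithLp.ofLp_injective 1 (Prod.ext (Subtype.ext h1) h2))

theorem V.norm_eq (v : V Ω p) : ‖v‖ = ‖V.pair Ω p v‖ + ‖toL2 Ω p v‖ :=
  WithLp.prod_norm_eq_of_L1 (Subtype.val (p := (· ∈ sobolevV Ω p)) v)

theorem norm_toL2_le (v : V Ω p) : ‖toL2 Ω p v‖ ≤ ‖v‖ := by
  rw [V.norm_eq v]
  linarith [norm_nonneg (V.pair Ω p v)]

theorem gradient_mul_shift {γ φ : Space N → ℝ} (hγ : ContDiff ℝ ∞ γ) (hφ : ContDiff ℝ ∞ φ)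
    (x z : Space N) :
    gradient (fun y => γ y * φ (y + z)) x = γ x • gradient φ (x + z) + φ (x + z) • gradient γ x := by
  have h1 : DifferentiableAt ℝ γ x := (hγ.differentiable (by simp)).differentiableAt
  have h2 : DifferentiableAt ℝ (fun y => φ (y + z)) x :=
    ((hφ.differentiable (by simp)).comp (differentiable_id.add_const z)).differentiableAt
  simp only [gradient]
  rw [fderiv_fun_mul h1 h2, fderiv_comp_add_right, map_add, map_smul, map_smul]

/-- The map `v ↦ (x ↦ γ(x) v(x + z))` for a smooth cutoff `γ` acts on pairs
`(v, ∇v)` and preserves `W_0^{1,p}(Ω)`. -/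
theorem exists_cutoffShift_field (hΩ : MeasurableSet Ω) {γ : Space N → ℝ} (hγ : ContDiff ℝ ∞ γ)
    (hc : HasCompactSupport γ) (hs : tsupport γ ⊆ Ω) {z : Space N}
    (hz : ∀ x ∈ tsupport γ, x + z ∈ Ω) {C D : ℝ} (hC0 : 0 ≤ C) (hD0 : 0 ≤ D) (hC : ∀ x, ‖γ x‖ ≤ C)
    (hD : ∀ x, ‖gradient γ x‖ ≤ D) :
    ∃ B : FieldPair Ω p →L[ℝ] FieldPair Ω p, (∀ w, ‖B w‖ ≤ (C + D) * ‖w‖) ∧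
      (∀ w, (B w).fst =ᵐ[volume.restrict Ω] fun x => γ x * w.fst (x + z)) ∧
      ∀ w ∈ W01p Ω p, B w ∈ W01p Ω p := by
  have hgrad : Continuous (gradient γ) :=
    (InnerProductSpace.toDual ℝ (Space N)).symm.continuous.comp (hγ.continuous_fderiv (by simp))
  have hgz : ∀ x, gradient γ x ≠ 0 → x + z ∈ Ω := fun x hx => hz x <| by
    by_contra hxt
    refine hx ?_
    simp [gradient, fderiv_of_notMem_tsupport ℝ hxt]
  have hγz : ∀ x, γ x ≠ 0 → x + z ∈ Ω := fun x hx => hz x (subset_tsupport _ hx)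
  obtain ⟨A₁, hA₁, hA₁'⟩ := exists_weightedShift (μ := (volume : Measure (Space N))) hΩ (z := z)
    (g := fun x => γ x • ContinuousLinearMap.id ℝ ℝ)
    (hγ.continuous.smul continuous_const) hC0
    (fun x => by simpa [norm_smul] using hC x) (fun x hx => hγz x fun h => hx (by simp [h])) p
  obtain ⟨A₂, hA₂, hA₂'⟩ := exists_weightedShift (μ := (volume : Measure (Space N))) hΩ (z := z)
    (g := fun x => γ x • ContinuousLinearMap.id ℝ (Space N))
    (hγ.continuous.smul continuous_const) hC0
    (fun x => by
      rw [norm_smul]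
      exact (mul_le_of_le_one_right (norm_nonneg _) ContinuousLinearMap.norm_id_le).trans (hC x))
    (fun x hx => hγz x fun h => hx (by simp [h])) p
  obtain ⟨A₃, hA₃, hA₃'⟩ := exists_weightedShift (μ := (volume : Measure (Space N))) hΩ (z := z)
    (g := fun x => ContinuousLinearMap.toSpanSingleton ℝ (gradient γ x))
    ((ContinuousLinearMap.toSpanSingletonCLE (𝕜 := ℝ) (E := Space N)).continuous.comp hgrad) hD0
    (fun x => by simpa using hD x)
    (fun x hx => hgz x fun h => hx (by simp [h])) p
  -- The second entry is the product rule $\gamma\,\nabla v(\cdot+z)+v(\cdot+z)\,\nabla\gamma$; the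
  -- term with $\nabla\gamma$ is the source of `D` in the bound.
  let L : FieldPair Ω p →ₗ[ℝ] FieldPair Ω p :=
    { toFun := fun w => WithLp.toLp 1 (A₁ w.fst, A₂ w.snd + A₃ w.fst)
      map_add' := fun v w => by
        apply WithLp.ofLp_injective
        simp only [WithLp.add_fst, WithLp.add_snd, map_add, WithLp.ofLp_add, Prod.mk_add_mk]
        congr 1
        abel
      map_smul' := fun c w => by
        apply WithLp.ofLp_injective
        simp [smul_add] }
  have hL : ∀ w, ‖L w‖ ≤ (C + D) * ‖w‖ := fun w => by
    rw [WithLp.prod_norm_eq_of_L1, WithLp.prod_norm_eq_of_L1]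
    have h1 := hA₁ w.fst
    have h2 := hA₂ w.snd
    have h3 := hA₃ w.fst
    have h4 : ‖(L w).snd‖ ≤ ‖A₂ w.snd‖ + ‖A₃ w.fst‖ := norm_add_le _ _
    have h5 : ‖(L w).fst‖ = ‖A₁ w.fst‖ := rfl
    nlinarith [mul_nonneg hD0 (norm_nonneg w.snd)]
  have hfst : ∀ w, (L w).fst =ᵐ[volume.restrict Ω] fun x => γ x * w.fst (x + z) := fun w => by
    have h1 : (L w).fst = A₁ w.fst := rfl
    rw [h1]
    filter_upwards [hA₁' w.fst] with x hx
    simpa using hx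
  refine ⟨L.mkContinuous _ hL, hL, hfst, fun w hw => ?_⟩
  -- By continuity only test functions matter, and $\gamma\,\varphi(\cdot+z)$ is again a test
  -- function in $\Omega$.
  refine map_mem_closure (L.mkContinuous _ hL).continuous hw fun w hw => ?_
  obtain ⟨φ, h1, h2, h3, h4, h5⟩ := hw
  have key : ∀ {P : Space N → Prop}, (∀ᵐ x ∂(volume.restrict Ω), P x) →
      ∀ᵐ x ∂(volume.restrict Ω), x + z ∈ Ω → P (x + z) := fun h =>
    ae_restrict_of_ae (ae_shift hΩ h z)
  refine ⟨fun y => γ y * φ (y + z), hγ.mul (h1.comp (contDiff_id.add contDiff_const)),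
    hc.mul_right, (closure_mono (Function.support_mul_subset_left _ _)).trans hs, ?_, ?_⟩
  · refine (hfst w).trans ?_
    filter_upwards [key h4] with x hx
    by_cases h : γ x = 0
    · simp [h]
    · rw [hx (hγz x h)]
  · have hsnd : (L w).snd =ᵐ[volume.restrict Ω] A₂ w.snd + A₃ w.fst := Lp.coeFn_add _ _
    refine hsnd.trans ?_
    filter_upwards [key h4, key h5, hA₂' w.snd, hA₃' w.fst] with x hx4 hx5 hx2 hx3
    rw [Pi.add_apply, hx2, hx3, gradient_mul_shift hγ h1]
    congr 1
    · by_cases h : γ x = 0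
      · simp [h]
      · simp [hx5 (hγz x h)]
    · by_cases h : gradient γ x = 0
      · simp [h]
      · simp [hx4 (hgz x h)]

/-- On `V`, the map `v ↦ (x ↦ γ(x) v(x + z))` for a smooth cutoff `γ`. -/
theorem exists_cutoffShift (hΩ : MeasurableSet Ω) {γ : Space N → ℝ} (hγ : ContDiff ℝ ∞ γ)
    (hc : HasCompactSupport γ) (hs : tsupport γ ⊆ Ω) {z : Space N}
    (hz : ∀ x ∈ tsupport γ, x + z ∈ Ω) {C D : ℝ} (hC0 : 0 ≤ C) (hD0 : 0 ≤ D) (hC : ∀ x, ‖γ x‖ ≤ C)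
    (hD : ∀ x, ‖gradient γ x‖ ≤ D) :
    ∃ M : V Ω p →L[ℝ] V Ω p, ‖M‖ ≤ C + D ∧
      ∀ v, toL2 Ω p (M v) =ᵐ[volume.restrict Ω] fun x => γ x * toL2 Ω p v (x + z) := by
  obtain ⟨B, hB, hB1, hB2⟩ := exists_cutoffShift_field (p := p) hΩ hγ hc hs hz hC0 hD0 hC hD
  have hγz : ∀ x, γ x ≠ 0 → x + z ∈ Ω := fun x hx => hz x (subset_tsupport _ hx)
  obtain ⟨A, hA, hA'⟩ := exists_weightedShift (μ := (volume : Measure (Space N))) hΩ (z := z)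
    (g := fun x => γ x • ContinuousLinearMap.id ℝ ℝ)
    (hγ.continuous.smul continuous_const) hC0
    (fun x => by simpa [norm_smul] using hC x) (fun x hx => hγz x fun h => hx (by simp [h])) 2
  have hA'' : ∀ f, A f =ᵐ[volume.restrict Ω] fun x => γ x * f (x + z) := fun f => by
    filter_upwards [hA' f] with x hx
    simpa using hx
  have hcompat : ∀ v : V Ω p, (B (V.pair Ω p v)).fst =ᵐ[volume.restrict Ω] A (toL2 Ω p v) := by
    intro v
    refine (hB1 _).trans (Filter.EventuallyEq.trans ?_ (hA'' _).symm)
    filter_upwards [ae_restrict_of_ae (ae_shift hΩ (V.pair_fst_ae v) z)] with x hx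
    by_cases h : γ x = 0
    · simp [h]
    · rw [hx (hγz x h)]
  let L : V Ω p →ₗ[ℝ] V Ω p :=
    { toFun := fun v => V.mk (B (V.pair Ω p v)) (hB2 _ (V.pair_mem v)) (A (toL2 Ω p v)) (hcompat v)
      map_add' := fun v w => V.ext_pair (by simp) (by simp)
      map_smul' := fun c v => V.ext_pair (by simp) (by simp) }
  refine ⟨L.mkContinuous (C + D) fun v => ?_, L.mkContinuous_norm_le (by positivity) _,
    fun v => hA'' (toL2 Ω p v)⟩
  rw [V.norm_eq, V.norm_eq]
  have h1 := hB (V.pair Ω p v)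
  have h2 := hA (toL2 Ω p v)
  have h3 := mul_nonneg hD0 (norm_nonneg (toL2 Ω p v))
  change ‖B (V.pair Ω p v)‖ + ‖A (toL2 Ω p v)‖ ≤ _
  linarith

end SobolevOperators

/-! ### Sup bounds from a weak time derivative. -/

section WeakDerivative

/-- A smooth function supported in `[a, b]` with vanishing integral has a primitive supported in
`[a, b]`, bounded by the `L¹` norm. -/
theorem exists_primitive_of_integral_eq_zero {h : ℝ → ℝ} (hh : ContDiff ℝ ∞ h) {a b : ℝ}
    (ha : 0 < a) (hs : Function.support h ⊆ Icc a b) (h0 : ∫ t, h t = 0) :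
    ∃ Φ : ℝ → ℝ, ContDiff ℝ ∞ Φ ∧ HasCompactSupport Φ ∧ tsupport Φ ⊆ Icc a b ∧
      deriv Φ = h ∧ ∀ t, ‖Φ t‖ ≤ ∫ s, ‖h s‖ := by
  have hd : ∀ t, HasDerivAt (fun t => ∫ s in (0 : ℝ)..t, h s) (h t) t := fun t =>
    intervalIntegral.integral_hasDerivAt_right (hh.continuous.intervalIntegrable _ _)
      (hh.continuous.stronglyMeasurableAtFilter _ _) hh.continuous.continuousAt
  have hderiv : deriv (fun t => ∫ s in (0 : ℝ)..t, h s) = h := funext fun t => (hd t).deriv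
  have hsupp : Function.support (fun t => ∫ s in (0 : ℝ)..t, h s) ⊆ Icc a b := by
    intro t ht
    by_contra hab
    refine ht ?_
    rcases lt_or_ge t a with hta | hta
    · refine intervalIntegral.integral_zero_ae (Filter.Eventually.of_forall fun s hs' => ?_)
      by_contra hne
      have h1 := (hs hne).1
      rcases le_total 0 t with h2 | h2
      · rw [uIoc_of_le h2] at hs'
        linarith [hs'.2]
      · rw [uIoc_of_ge h2] at hs'
        linarith [hs'.2]
    · have hbt : b < t := not_le.1 fun h => hab ⟨hta, h⟩
      change ∫ s in (0 : ℝ)..t, h s = 0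
      rw [intervalIntegral.integral_eq_integral_of_support_subset, h0]
      exact fun s hs' => ⟨ha.trans_le (hs hs').1, (hs hs').2.trans hbt.le⟩
  have htsupp := closure_minimal hsupp isClosed_Icc
  have hint : Integrable h := hh.continuous.integrable_of_hasCompactSupport
    (HasCompactSupport.intro isCompact_Icc fun x hx => Function.notMem_support.1 fun h => hx (hs h))
  refine ⟨fun t => ∫ s in (0 : ℝ)..t, h s, ?_, ?_, htsupp, hderiv, fun t => ?_⟩
  · exact contDiff_infty_iff_deriv.2 ⟨fun t => (hd t).differentiableAt, by rwa [hderiv]⟩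
  · exact isCompact_Icc.of_isClosed_subset isClosed_closure htsupp
  · exact intervalIntegral.norm_integral_le_integral_norm_uIoc.trans
      (setIntegral_le_integral hint.norm (Filter.Eventually.of_forall fun _ => norm_nonneg _))

variable {E : Type*} [NormedAddCommGroup E] [NormedSpace ℝ E]

/-- `W^{1,1}(0,T;E) ⊂ L^∞(0,T;E)` with a bound, tested against unit masses. -/
theorem norm_integral_smul_le_of_weakDeriv {T : ℝ} {θ ψ : ℝ → ℝ} {a b B : ℝ}
    (ha : 0 < a) (hb : b < T) (hθ : ContDiff ℝ ∞ θ) (hθs : Function.support θ ⊆ Icc a b)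
    (hθ0 : ∀ t, 0 ≤ θ t) (hθB : ∀ t, θ t ≤ B) (hθ1 : ∫ t, θ t = 1)
    (hψ : ContDiff ℝ ∞ ψ) (hψs : Function.support ψ ⊆ Icc a b)
    (hψ0 : ∀ t, 0 ≤ ψ t) (hψ1 : ∫ t, ψ t = 1) {g F : ℝ → E}
    (hg : IntegrableOn g (Ioo 0 T)) (hF : IntegrableOn F (Ioo 0 T))
    (hgF : ∀ φ : ℝ → ℝ, ContDiff ℝ ∞ φ → HasCompactSupport φ → tsupport φ ⊆ Ioo 0 T →
      ∫ t in Ioo 0 T, deriv φ t • g t = -∫ t in Ioo 0 T, φ t • F t) :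
    ‖∫ t in Ioo 0 T, ψ t • g t‖ ≤
      B * (∫ t in Ioo 0 T, ‖g t‖) + 2 * ∫ t in Ioo 0 T, ‖F t‖ := by
  have hcs : ∀ {f : ℝ → ℝ}, Function.support f ⊆ Icc a b → HasCompactSupport f := fun hf =>
    HasCompactSupport.intro isCompact_Icc fun x hx => Function.notMem_support.1 fun h => hx (hf h)
  have hψi : Integrable ψ := hψ.continuous.integrable_of_hasCompactSupport (hcs hψs)
  have hθi : Integrable θ := hθ.continuous.integrable_of_hasCompactSupport (hcs hθs)
  have hsm : ∀ {f : ℝ → ℝ}, ContDiff ℝ ∞ f → Function.support f ⊆ Icc a b →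
      IntegrableOn (fun t => f t • g t) (Ioo 0 T) := fun {f} hf hfs => by
    obtain ⟨c, hc⟩ := hf.continuous.bounded_above_of_compact_support (hcs hfs)
    exact hg.bdd_smul c hf.continuous.aestronglyMeasurable (Filter.Eventually.of_forall hc)
  -- Since $\psi-\theta$ has mean zero, its primitive $\Phi$ is an admissible test function, giving
  -- $\int\psi g=\int\theta g-\int\Phi F$. The constant $2$ bounds $\|\psi-\theta\|_{L^1}$.
  obtain ⟨Φ, hΦ, hΦc, hΦs, hΦd, hΦb⟩ := exists_primitive_of_integral_eq_zero (hψ.sub hθ) ha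
    ((Function.support_sub _ _).trans (union_subset hψs hθs))
    (by rw [integral_sub hψi hθi, hψ1, hθ1, sub_self])
  have hb2 : ∀ t, ‖Φ t‖ ≤ 2 := fun t => by
    refine (hΦb t).trans ?_
    calc ∫ s, ‖ψ s - θ s‖ ≤ ∫ s, (ψ s + θ s) := by
          refine integral_mono (hψi.sub hθi).norm (hψi.add hθi) fun s => ?_
          refine (norm_sub_le _ _).trans ?_
          rw [Real.norm_of_nonneg (hψ0 s), Real.norm_of_nonneg (hθ0 s)]
      _ = 2 := by rw [integral_add hψi hθi, hψ1, hθ1]; norm_num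
  have key := hgF Φ hΦ hΦc (hΦs.trans fun t ht => ⟨ha.trans_le ht.1, ht.2.trans_lt hb⟩)
  rw [hΦd] at key
  simp only [sub_smul] at key
  rw [integral_sub (hsm hψ hψs) (hsm hθ hθs), sub_eq_iff_eq_add] at key
  rw [key]
  have e1 : ‖∫ t in Ioo 0 T, Φ t • F t‖ ≤ 2 * ∫ t in Ioo 0 T, ‖F t‖ := by
    rw [← integral_const_mul]
    refine norm_integral_le_of_norm_le (hF.norm.const_mul 2) (Filter.Eventually.of_forall fun t => ?_)
    rw [norm_smul]
    exact mul_le_mul_of_nonneg_right (hb2 t) (norm_nonneg _)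
  have e2 : ‖∫ t in Ioo 0 T, θ t • g t‖ ≤ B * ∫ t in Ioo 0 T, ‖g t‖ := by
    rw [← integral_const_mul]
    refine norm_integral_le_of_norm_le (hg.norm.const_mul B) (Filter.Eventually.of_forall fun t => ?_)
    rw [norm_smul, Real.norm_of_nonneg (hθ0 t)]
    exact mul_le_mul_of_nonneg_right (hθB t) (norm_nonneg _)
  refine (norm_add_le _ _).trans ?_
  rw [norm_neg]
  linarith

/-- `W^{1,1}(0,T;E) ⊂ L^∞(0,T;E)`. -/
theorem exists_ae_norm_le_of_weakDeriv [CompleteSpace E] {T : ℝ} (hT : 0 < T) :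
    ∃ C : ℝ, 0 ≤ C ∧ ∀ g F : ℝ → E, IntegrableOn g (Ioo 0 T) → IntegrableOn F (Ioo 0 T) →
      (∀ φ : ℝ → ℝ, ContDiff ℝ ∞ φ → HasCompactSupport φ → tsupport φ ⊆ Ioo 0 T →
        ∫ t in Ioo 0 T, deriv φ t • g t = -∫ t in Ioo 0 T, φ t • F t) →
      ∀ᵐ t ∂(volume.restrict (Ioo 0 T)),
        ‖g t‖ ≤ C * ((∫ t in Ioo 0 T, ‖g t‖) + ∫ t in Ioo 0 T, ‖F t‖) := by
  -- A fixed reference mass inside $(0,T)$; its supremum determines the constant. The masses `φ n`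
  -- concentrate, so that averages of `g` against them recover $g(t)$.
  let β : ContDiffBump (T / 2) := ⟨T / 8, T / 4, by linarith, by linarith⟩
  have hβc : HasCompactSupport (β.normed volume) := β.hasCompactSupport_normed
  obtain ⟨B, hB⟩ := (β.contDiff_normed (n := 0)).continuous.bounded_above_of_compact_support hβc
  refine ⟨max B 2, le_max_of_le_right zero_le_two, fun g F hg hF hgF => ?_⟩
  let φ : ℕ → ContDiffBump (0 : ℝ) := fun n =>
    ⟨1 / (2 * (n + 1)), 1 / (n + 1), by positivity, by gcongr; linarith⟩
  have hr : ∀ n, (φ n).rOut = 1 / ((n : ℝ) + 1) := fun n => rfl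
  have hlim : Filter.Tendsto (fun n => (φ n).rOut) Filter.atTop (nhds 0) :=
    tendsto_one_div_add_atTop_nhds_zero_nat
  -- Comparable inner and outer radii are what Lebesgue differentiation needs for convergence at
  -- almost every point.
  have hK : ∀ᶠ n in Filter.atTop, (φ n).rOut ≤ 2 * (φ n).rIn :=
    Filter.Eventually.of_forall fun n => by
      change 1 / ((n : ℝ) + 1) ≤ 2 * (1 / (2 * (n + 1)))
      apply le_of_eq
      field_simp
  have hg0 : Integrable ((Ioo 0 T).indicator g) := hg.integrable_indicator measurableSet_Ioo
  have hconv := ContDiffBump.ae_convolution_tendsto_right_of_locallyIntegrable (μ := volume)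
    hlim hK hg0.locallyIntegrable
  rw [ae_restrict_iff' measurableSet_Ioo]
  filter_upwards [hconv] with t ht htT
  rw [indicator_of_mem htT] at ht
  refine le_of_tendsto ht.norm ?_
  have hev : ∀ᶠ n in Filter.atTop, (φ n).rOut < min t (T - t) :=
    hlim.eventually_lt_const (lt_min htT.1 (sub_pos.2 htT.2))
  filter_upwards [hev] with n hn
  have hn1 := hn.trans_le (min_le_left _ _)
  have hn2 := hn.trans_le (min_le_right _ _)
  have hrpos := (φ n).rOut_pos
  have hsw : (MeasureTheory.convolution ((φ n).normed volume) ((Ioo 0 T).indicator g)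
      (ContinuousLinearMap.lsmul ℝ ℝ) volume) t =
      ∫ s in Ioo 0 T, (φ n).normed volume (t - s) • g s := by
    rw [convolution_lsmul_swap, ← integral_indicator measurableSet_Ioo]
    congr 1
    ext s
    by_cases hs : s ∈ Ioo 0 T <;> simp [hs]
  rw [hsw]
  -- The interval $[a,b]$ holds both the reference bump, supported in $[T/4,3T/4]$, and the bump
  -- centred at $t$, and stays inside $(0,T)$.
  have hbd := norm_integral_smul_le_of_weakDeriv (T := T) (θ := β.normed volume)
    (ψ := fun s => (φ n).normed volume (t - s)) (a := min (t - (φ n).rOut) (T / 4))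
    (b := max (t + (φ n).rOut) (3 * T / 4)) (B := B) (lt_min (by linarith) (by linarith))
    (max_lt (by linarith) (by linarith)) β.contDiff_normed
    (by
      rw [β.support_normed_eq, Real.ball_eq_Ioo]
      intro s hs
      have h1 : T / 2 - T / 4 < s := hs.1
      have h2 : s < T / 2 + T / 4 := hs.2
      exact ⟨(min_le_right _ _).trans (by linarith), le_trans (by linarith) (le_max_right _ _)⟩)
    (fun s => β.nonneg_normed s) (fun s => (le_abs_self _).trans (hB s)) β.integral_normed
    ((φ n).contDiff_normed.comp (contDiff_const.sub contDiff_id))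
    (by
      intro s hs
      have hs' : t - s ∈ Function.support ((φ n).normed volume) := hs
      rw [(φ n).support_normed_eq, Real.ball_eq_Ioo] at hs'
      exact ⟨(min_le_left _ _).trans (by linarith [hs'.2]),
        le_trans (by linarith [hs'.1]) (le_max_left _ _)⟩)
    (fun s => (φ n).nonneg_normed _)
    (by rw [integral_sub_left_eq_self (fun s => (φ n).normed volume s), (φ n).integral_normed])
    hg hF hgF
  refine hbd.trans ?_
  rw [mul_add]
  have i1 : 0 ≤ ∫ t in Ioo 0 T, ‖g t‖ := integral_nonneg fun _ => norm_nonneg _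
  have i2 : 0 ≤ ∫ t in Ioo 0 T, ‖F t‖ := integral_nonneg fun _ => norm_nonneg _
  gcongr
  · exact le_max_left _ _
  · exact le_max_right _ _

end WeakDerivative

/-! ### The pivot embedding $V\subset V'$ and the adjoint of a cutoff translation. -/

section Translation

variable {N : ℕ} {Ω : Set (Space N)} {p : ℝ≥0∞} [Fact (1 ≤ p)]

theorem toDual_apply (v w : V Ω p) :
    toDual Ω p v w = inner ℝ (toL2 Ω p v) (toL2 Ω p w) := rfl

theorem toDual_add (v w : V Ω p) : toDual Ω p (v + w) = toDual Ω p v + toDual Ω p w := by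
  ext x
  simp only [toDual_apply, map_add, inner_add_left, add_apply]

theorem toDual_smul (c : ℝ) (v : V Ω p) : toDual Ω p (c • v) = c • toDual Ω p v := by
  ext x
  simp only [toDual_apply, map_smul, real_inner_smul_left, smul_apply,
    smul_eq_mul]

theorem norm_toDual_le (v : V Ω p) : ‖toDual Ω p v‖ ≤ ‖v‖ :=
  ContinuousLinearMap.opNorm_le_bound _ (norm_nonneg _) fun w =>
    (norm_inner_le_norm _ _).trans
      (mul_le_mul (norm_toL2_le v) (norm_toL2_le w) (norm_nonneg _) (norm_nonneg _))

variable (Ω p) in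
/-- The inclusion `V ⊂ V'` as a continuous linear map. -/
def toDualL : V Ω p →L[ℝ] VDual Ω p :=
  LinearMap.mkContinuous ⟨⟨toDual Ω p, toDual_add⟩, toDual_smul⟩ 1 fun v =>
    (norm_toDual_le v).trans_eq (one_mul _).symm

/-- The maps `v ↦ γ(x) v(x + z)` and `w ↦ γ(x - z) w(x - z)` are adjoint in `L²`. -/
theorem toDual_cutoffShift (hΩ : MeasurableSet Ω) {γ : Space N → ℝ} {z : Space N}
    (hs : ∀ x, γ x ≠ 0 → x ∈ Ω ∧ x + z ∈ Ω) {M M' : V Ω p →L[ℝ] V Ω p}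
    (hM : ∀ v, toL2 Ω p (M v) =ᵐ[volume.restrict Ω] fun x => γ x * toL2 Ω p v (x + z))
    (hM' : ∀ v, toL2 Ω p (M' v) =ᵐ[volume.restrict Ω] fun x => γ (x + -z) * toL2 Ω p v (x + -z))
    (v : V Ω p) : toDual Ω p (M v) = (toDual Ω p v).comp M' := by
  ext w
  rw [ContinuousLinearMap.comp_apply, toDual_apply, toDual_apply, L2.inner_def, L2.inner_def]
  have h1 : ∫ x in Ω, inner ℝ (toL2 Ω p (M v) x) (toL2 Ω p w x) =
      ∫ x, γ x * (toL2 Ω p v (x + z) * toL2 Ω p w x) := by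
    rw [← integral_indicator hΩ]
    refine integral_congr_ae ?_
    filter_upwards [(ae_restrict_iff' hΩ).1 (hM v)] with x hx
    by_cases hxΩ : x ∈ Ω
    · rw [indicator_of_mem hxΩ, hx hxΩ, real_inner_eq_re_inner, RCLike.inner_apply]
      simp
      ring
    · have : γ x = 0 := by
        by_contra h
        exact hxΩ (hs x h).1
      rw [indicator_of_notMem hxΩ, this, zero_mul]
  have h2 : ∫ x in Ω, inner ℝ (toL2 Ω p v x) (toL2 Ω p (M' w) x) =
      ∫ x, γ (x + -z) * (toL2 Ω p v (x + -z + z) * toL2 Ω p w (x + -z)) := by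
    rw [← integral_indicator hΩ]
    refine integral_congr_ae ?_
    filter_upwards [(ae_restrict_iff' hΩ).1 (hM' w)] with x hx
    by_cases hxΩ : x ∈ Ω
    · rw [indicator_of_mem hxΩ, hx hxΩ, neg_add_cancel_right, real_inner_eq_re_inner,
        RCLike.inner_apply]
      simp
      ring
    · have : γ (x + -z) = 0 := by
        by_contra h
        exact hxΩ (by simpa using (hs _ h).2)
      rw [indicator_of_notMem hxΩ, this, zero_mul]
  rw [h1, h2, integral_add_right_eq_self
    (fun x => γ x * (toL2 Ω p v (x + z) * toL2 Ω p w x))]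

theorem exists_pos_forall_add_mem {X : Type*} [SeminormedAddCommGroup X] {K U : Set X}
    (hK : IsCompact K) (hU : IsOpen U) (h : K ⊆ U) :
    ∃ δ, 0 < δ ∧ ∀ x ∈ K, ∀ z, ‖z‖ < δ → x + z ∈ U := by
  obtain ⟨δ, hδ, hsub⟩ := hK.exists_thickening_subset_open hU h
  refine ⟨δ, hδ, fun x hx z hz => hsub (Metric.mem_thickening_iff.2 ⟨x, hx, ?_⟩)⟩
  simpa [dist_eq_norm] using hz

/-- A cutoff composed with a small translation acts boundedly on `V`, uniformly in the
translation, and so does its `L²`-adjoint. -/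
theorem exists_cutoffShift_adjoint (hΩ : IsOpen Ω) {γ : Space N → ℝ} (hγ : ContDiff ℝ ∞ γ)
    (hc : HasCompactSupport γ) (hs : tsupport γ ⊆ Ω) :
    ∃ δ, 0 < δ ∧ ∃ C, 0 ≤ C ∧ ∀ z : Space N, ‖z‖ < δ → ∃ M M' : V Ω p →L[ℝ] V Ω p,
      ‖M‖ ≤ C ∧ ‖M'‖ ≤ C ∧ (∀ v, toDual Ω p (M v) = (toDual Ω p v).comp M') ∧
      ∀ v, ∀ᵐ x ∂(volume.restrict Ω), (γ x ≠ 0 → x + z ∈ Ω) ∧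
        toL2 Ω p (M v) x = γ x * toL2 Ω p v (x + z) := by
  obtain ⟨δ, hδ, hδz⟩ := exists_pos_forall_add_mem hc.isCompact hΩ hs
  obtain ⟨C, hC⟩ := hγ.continuous.bounded_above_of_compact_support hc
  obtain ⟨D, hD⟩ := (hγ.continuous_fderiv (by simp)).bounded_above_of_compact_support
    (hc.fderiv (𝕜 := ℝ))
  have hD' : ∀ x, ‖gradient γ x‖ ≤ D := fun x => by simpa [gradient] using hD x
  have hC0 : 0 ≤ C := (norm_nonneg _).trans (hC 0)
  have hD0 : 0 ≤ D := (norm_nonneg _).trans (hD 0)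
  refine ⟨δ, hδ, C + D, by positivity, fun z hz => ?_⟩
  have hz1 : ∀ x ∈ tsupport γ, x + z ∈ Ω := fun x hx => hδz x hx z hz
  have hγz : ∀ x, γ x ≠ 0 → x ∈ Ω ∧ x + z ∈ Ω := fun x hx =>
    ⟨hs (subset_tsupport _ hx), hz1 x (subset_tsupport _ hx)⟩
  have hts : tsupport (fun x => γ (x + -z)) ⊆ (fun x => x + -z) ⁻¹' tsupport γ :=
    closure_minimal (fun x hx => subset_tsupport γ hx)
      (isClosed_closure.preimage (continuous_add_const (-z)))
  obtain ⟨M, hM, hM1⟩ := exists_cutoffShift (p := p) hΩ.measurableSet hγ hc hs hz1 hC0 hD0 hC hD'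
  -- The $L^2$-adjoint is itself a cutoff translation, with cutoff $\gamma(\cdot-z)$ and shift $-z$,
  -- hence bounded on $V$ by the same constants.
  obtain ⟨M', hM', hM'1⟩ := exists_cutoffShift (p := p) hΩ.measurableSet
    (γ := fun x => γ (x + -z)) (z := -z) (hγ.comp (contDiff_id.add contDiff_const))
    (hc.comp_homeomorph (Homeomorph.addRight (-z)))
    (fun x hx => by simpa using hz1 _ (hts hx)) (fun x hx => hs (hts hx)) hC0 hD0
    (fun x => hC _)
    (fun x => by
      have : gradient (fun x => γ (x + -z)) x = gradient γ (x + -z) := by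
        simp only [gradient, fderiv_comp_add_right]
      rw [this]
      exact hD' _)
  refine ⟨M, M', hM, hM', toDual_cutoffShift hΩ.measurableSet hγz hM1 hM'1, fun v => ?_⟩
  filter_upwards [hM1 v] with x hx
  exact ⟨fun h => (hγz x h).2, hx⟩

end Translation

/-! ### Cutoff and translation in time for weak derivatives. -/

section TimeTranslation

variable {E E' : Type*} [NormedAddCommGroup E] [NormedSpace ℝ E]
  [NormedAddCommGroup E'] [NormedSpace ℝ E']

theorem setIntegral_smul_shift {S : Set ℝ} (hS : MeasurableSet S) {k : ℝ → ℝ} {σ : ℝ}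
    (hk : ∀ t, k t ≠ 0 → t ∈ S ∧ t + σ ∈ S) (G : ℝ → E) :
    ∫ t in S, k t • G (t + σ) = ∫ t in S, k (t - σ) • G t := by
  have h1 : ∫ t in S, k t • G (t + σ) = ∫ t, k t • G (t + σ) := by
    rw [← integral_indicator hS]
    congr 1
    ext t
    by_cases ht : t ∈ S
    · rw [indicator_of_mem ht]
    · have : k t = 0 := by
        by_contra h
        exact ht (hk t h).1
      rw [indicator_of_notMem ht, this, zero_smul]
  have h2 : ∫ t in S, k (t - σ) • G t = ∫ t, k (t - σ) • G t := by
    rw [← integral_indicator hS]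
    congr 1
    ext t
    by_cases ht : t ∈ S
    · rw [indicator_of_mem ht]
    · have : k (t - σ) = 0 := by
        by_contra h
        exact ht (by simpa using (hk _ h).2)
      rw [indicator_of_notMem ht, this, zero_smul]
  rw [h1, h2, ← integral_add_right_eq_self (fun t => k (t - σ) • G t) σ]
  simp

theorem integrableOn_smul_shift {S : Set ℝ} (hS : MeasurableSet S) {k : ℝ → ℝ} (hk : Continuous k)
    (hkc : HasCompactSupport k) {σ : ℝ} (hks : ∀ t, k t ≠ 0 → t + σ ∈ S) {G : ℝ → E}
    (hG : IntegrableOn G S) : IntegrableOn (fun t => k t • G (t + σ)) S := by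
  obtain ⟨c, hc⟩ := hk.bounded_above_of_compact_support hkc
  have h := memLp_weightedShift (μ := volume) (S := S) (S' := S) hS
    (z := σ) (g := fun t => k t • ContinuousLinearMap.id ℝ E) (hk.smul continuous_const) (C := c)
    (fun t => by
      rw [norm_smul]
      exact (mul_le_of_le_one_right (norm_nonneg _) ContinuousLinearMap.norm_id_le).trans (hc t))
    (fun t ht => hks t fun h => ht (by simp [h])) (memLp_one_iff_integrable.2 hG)
  exact memLp_one_iff_integrable.1 h

theorem integrableOn_sub_smul {S : Set ℝ} {k : ℝ → ℝ} (hk : Continuous k)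
    (hkc : HasCompactSupport k) (σ : ℝ) {G : ℝ → E}
    (hG : IntegrableOn G S) : IntegrableOn (fun t => k (t - σ) • G t) S := by
  obtain ⟨c, hc⟩ := hk.bounded_above_of_compact_support hkc
  exact hG.bdd_smul c (hk.comp (continuous_sub_right σ)).aestronglyMeasurable
    (Filter.Eventually.of_forall fun t => hc _)

/-- The product rule and invariance under translation for weak derivatives, composed with a
continuous linear map. -/
theorem weakDeriv_cutoffShift [CompleteSpace E] [CompleteSpace E'] {T : ℝ} {g F : ℝ → E}
    (hg : IntegrableOn g (Ioo 0 T)) (hF : IntegrableOn F (Ioo 0 T))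
    (hgF : ∀ φ : ℝ → ℝ, ContDiff ℝ ∞ φ → HasCompactSupport φ → tsupport φ ⊆ Ioo 0 T →
      ∫ t in Ioo 0 T, deriv φ t • g t = -∫ t in Ioo 0 T, φ t • F t)
    {α : ℝ → ℝ} (hα : ContDiff ℝ ∞ α) {σ : ℝ}
    (hασ : ∀ t ∈ tsupport α, t + σ ∈ Ioo 0 T) (R : E →L[ℝ] E')
    {φ : ℝ → ℝ} (hφ : ContDiff ℝ ∞ φ) (hφc : HasCompactSupport φ) (hφs : tsupport φ ⊆ Ioo 0 T) :
    ∫ t in Ioo 0 T, deriv φ t • (α t • R (g (t + σ))) =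
      -∫ t in Ioo 0 T, φ t • (deriv α t • R (g (t + σ)) + α t • R (F (t + σ))) := by
  have hRg : IntegrableOn (fun t => R (g t)) (Ioo 0 T) := R.integrable_comp hg
  have hRF : IntegrableOn (fun t => R (F t)) (Ioo 0 T) := R.integrable_comp hF
  have hdα : ∀ t, deriv α t ≠ 0 → t ∈ tsupport α := fun t ht => by
    by_contra h
    exact ht (image_eq_zero_of_notMem_tsupport fun h' => h (tsupport_deriv_subset h'))
  have hdφ : ∀ t, deriv φ t ≠ 0 → t ∈ tsupport φ := fun t ht => by
    by_contra h
    exact ht (image_eq_zero_of_notMem_tsupport fun h' => h (tsupport_deriv_subset h'))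
  have hk1 : ∀ t, deriv φ t * α t ≠ 0 → t ∈ Ioo 0 T ∧ t + σ ∈ Ioo 0 T := fun t ht =>
    ⟨hφs (hdφ t (left_ne_zero_of_mul ht)),
      hασ t (subset_tsupport _ (right_ne_zero_of_mul ht))⟩
  have hk2 : ∀ t, φ t * deriv α t ≠ 0 → t ∈ Ioo 0 T ∧ t + σ ∈ Ioo 0 T := fun t ht =>
    ⟨hφs (subset_tsupport _ (left_ne_zero_of_mul ht)), hασ t (hdα t (right_ne_zero_of_mul ht))⟩
  have hk3 : ∀ t, φ t * α t ≠ 0 → t ∈ Ioo 0 T ∧ t + σ ∈ Ioo 0 T := fun t ht =>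
    ⟨hφs (subset_tsupport _ (left_ne_zero_of_mul ht)),
      hασ t (subset_tsupport _ (right_ne_zero_of_mul ht))⟩
  have hdφc : Continuous (deriv φ) := hφ.continuous_deriv (by simp)
  have hdαc : Continuous (deriv α) := hα.continuous_deriv (by simp)
  have hψ : ContDiff ℝ ∞ (fun t => φ (t - σ) * α (t - σ)) :=
    (hφ.mul hα).comp (contDiff_id.sub contDiff_const)
  have hψd : ∀ t, deriv (fun t => φ (t - σ) * α (t - σ)) t =
      deriv φ (t - σ) * α (t - σ) + φ (t - σ) * deriv α (t - σ) := fun t => by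
    have h1 : DifferentiableAt ℝ φ (t - σ) := (hφ.differentiable (by simp)).differentiableAt
    have h2 : DifferentiableAt ℝ α (t - σ) := (hα.differentiable (by simp)).differentiableAt
    rw [deriv_comp_sub_const (fun t => φ t * α t) σ t, deriv_fun_mul h1 h2]
  have hψs : tsupport (fun t => φ (t - σ) * α (t - σ)) ⊆ (fun t => t - σ) ⁻¹' tsupport α :=
    closure_minimal (fun t ht => subset_tsupport α (right_ne_zero_of_mul ht))
      (isClosed_closure.preimage (continuous_sub_right σ))
  have hψc : HasCompactSupport (fun t => φ (t - σ) * α (t - σ)) :=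
    (hφc.mul_right (f' := α)).comp_homeomorph (Homeomorph.subRight σ)
  -- The equation for `g` is tested with $(\varphi\alpha)(\cdot-\sigma)$, supported in $(0,T)$
  -- because $\operatorname{supp}\alpha+\sigma$ is. Shifting back and applying `R` gives the claim.
  have key := hgF _ hψ hψc fun t ht => by simpa using hασ _ (hψs ht)
  have c1 : Continuous fun t => deriv φ t * α t := hdφc.mul hα.continuous
  have c2 : Continuous fun t => φ t * deriv α t := hφ.continuous.mul hdαc
  have c3 : Continuous fun t => φ t * α t := hφ.continuous.mul hα.continuous
  have s1 : HasCompactSupport fun t => deriv φ t * α t := hφc.deriv.mul_right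
  have s2 : HasCompactSupport fun t => φ t * deriv α t := hφc.mul_right
  have s3 : HasCompactSupport fun t => φ t * α t := hφc.mul_right
  have i1 := integrableOn_sub_smul c1 s1 σ hg
  have i2 := integrableOn_sub_smul c2 s2 σ hg
  have i3 := integrableOn_sub_smul c3 s3 σ hF
  have j2 := integrableOn_smul_shift measurableSet_Ioo c2 s2 (fun t ht => (hk2 t ht).2) hRg
  have j3 := integrableOn_smul_shift measurableSet_Ioo c3 s3 (fun t ht => (hk3 t ht).2) hRF
  have r1 := R.integral_comp_comm i1
  have r2 := R.integral_comp_comm i2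
  have r3 := R.integral_comp_comm i3
  have e1 := setIntegral_smul_shift measurableSet_Ioo hk1 (fun t => R (g t))
  have e2 := setIntegral_smul_shift measurableSet_Ioo hk2 (fun t => R (g t))
  have e3 := setIntegral_smul_shift measurableSet_Ioo hk3 (fun t => R (F t))
  simp only [hψd, add_smul] at key
  rw [integral_add i1 i2] at key
  have keyR := congrArg R key
  rw [map_add, map_neg, ← r1, ← r2, ← r3] at keyR
  simp only [map_smul] at keyR
  simp only [smul_add, smul_smul]
  rw [integral_add j2 j3, e1, e2, e3, neg_add, ← keyR]
  abel

end TimeTranslation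

/-! ### Capacity under small localized translations. -/

section CapacityTranslation

theorem norm_smul_clm_le {E E' : Type*} [NormedAddCommGroup E] [NormedSpace ℝ E]
    [NormedAddCommGroup E'] [NormedSpace ℝ E'] {R : E →L[ℝ] E'} {C A a : ℝ} (hR : ‖R‖ ≤ C)
    (ha : ‖a‖ ≤ A) : ‖a • R‖ ≤ A * C := by
  rw [norm_smul]
  exact mul_le_mul ha hR (norm_nonneg _) ((norm_nonneg _).trans ha)

theorem scalar_ne_zero_of_smul_clm_ne_zero {E E' : Type*} [NormedAddCommGroup E] [NormedSpace ℝ E]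
    [NormedAddCommGroup E'] [NormedSpace ℝ E'] {R : E →L[ℝ] E'} {a : ℝ} (h : a • R ≠ 0) :
    a ≠ 0 :=
  fun h0 => h (by rw [h0, zero_smul])

variable {N : ℕ} {Ω : Set (Space N)} {p : ℝ≥0∞} [Fact (1 ≤ p)]

theorem one_le_conjExponent (p : ℝ≥0∞) : 1 ≤ ENNReal.conjExponent p := le_self_add

theorem MemW.integrableOn_toDual {T : ℝ} {u : ℝ → V Ω p} {F : ℝ → VDual Ω p}
    (h : MemW Ω p T u F) : IntegrableOn (fun t => toDual Ω p (u t)) (Ioo 0 T) :=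
  (toDualL Ω p).integrable_comp (h.memLp.integrable Fact.out)

theorem MemW.integrableOn_deriv {T : ℝ} {u : ℝ → V Ω p} {F : ℝ → VDual Ω p}
    (h : MemW Ω p T u F) : IntegrableOn F (Ioo 0 T) :=
  h.memLp_deriv.integrable (one_le_conjExponent p)

theorem eLpNorm_one_restrict_Ioo_le {E : Type*} [NormedAddCommGroup E] (T : ℝ) {q : ℝ≥0∞}
    (hq : 1 ≤ q) : ∃ C : ℝ≥0∞, C ≠ ⊤ ∧ ∀ f : ℝ → E,
      AEStronglyMeasurable f (volume.restrict (Ioo 0 T)) →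
      eLpNorm f 1 (volume.restrict (Ioo 0 T)) ≤ C * eLpNorm f q (volume.restrict (Ioo 0 T)) := by
  refine ⟨volume.restrict (Ioo 0 T) univ ^ (1 / (1 : ℝ≥0∞).toReal - 1 / q.toReal), ?_,
    fun f hf => (eLpNorm_le_eLpNorm_mul_rpow_measure_univ hq hf).trans_eq (mul_comm _ _)⟩
  refine ENNReal.rpow_ne_top_of_nonneg ?_ (measure_ne_top _ _)
  rw [ENNReal.toReal_one, div_one, sub_nonneg]
  rcases eq_or_ne q ⊤ with rfl | h
  -- Here `⊤.toReal = 0` and division by zero gives zero, so the exponent is $1$.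
  · simp
  · have h1 : 1 ≤ q.toReal := by simpa using ENNReal.toReal_mono h hq
    exact (div_le_one (zero_lt_one.trans_le h1)).2 h1

/-- `W ⊂ L^{p'}(0,T;V')`, with a bound. -/
theorem exists_eLpNorm_toDual_le {T : ℝ} (hT : 0 < T) :
    ∃ C : ℝ≥0∞, C ≠ ⊤ ∧ ∀ (u : ℝ → V Ω p) (F : ℝ → VDual Ω p), MemW Ω p T u F →
      eLpNorm (fun t => toDual Ω p (u t)) (ENNReal.conjExponent p) (volume.restrict (Ioo 0 T)) ≤
        C * normW Ω p T u F := by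
  obtain ⟨C₀, hC₀, hC₀'⟩ := exists_ae_norm_le_of_weakDeriv (E := VDual Ω p) hT
  obtain ⟨a, ha, ha'⟩ := eLpNorm_one_restrict_Ioo_le (E := V Ω p) T (q := p) Fact.out
  obtain ⟨b, hb, hb'⟩ := eLpNorm_one_restrict_Ioo_le (E := VDual Ω p) T (one_le_conjExponent p)
  set q := ENNReal.conjExponent p
  refine ⟨volume.restrict (Ioo 0 T) univ ^ q.toReal⁻¹ * (ENNReal.ofReal C₀ * (a + b)), ?_,
    fun u F h => ?_⟩
  · refine ENNReal.mul_ne_top ?_ (ENNReal.mul_ne_top ENNReal.ofReal_ne_top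
      (ENNReal.add_ne_top.2 ⟨ha, hb⟩))
    exact ENNReal.rpow_ne_top_of_nonneg (by positivity) (measure_ne_top _ _)
  -- The essential bound in $V'$ gives every exponent on the bounded interval, including $p'>p$.
  refine (eLpNorm_le_of_ae_bound
    (hC₀' _ F h.integrableOn_toDual h.integrableOn_deriv h.isTimeDerivative)).trans ?_
  rw [mul_assoc]
  gcongr
  rw [ENNReal.ofReal_mul hC₀, ENNReal.ofReal_add (integral_nonneg fun _ => norm_nonneg _)
    (integral_nonneg fun _ => norm_nonneg _),
    ofReal_integral_norm_eq_lintegral_enorm h.integrableOn_toDual,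
    ofReal_integral_norm_eq_lintegral_enorm h.integrableOn_deriv,
    ← eLpNorm_one_eq_lintegral_enorm, ← eLpNorm_one_eq_lintegral_enorm, mul_assoc]
  gcongr
  rw [add_mul]
  gcongr
  · refine (eLpNorm_mono fun t => norm_toDual_le (u t)).trans
      ((ha' u h.memLp.1).trans ?_)
    gcongr
    exact le_self_add
  · refine (hb' F h.memLp_deriv.1).trans ?_
    gcongr
    exact le_add_self

/-- Small translations of an open set, localized by a cutoff, have capacity controlled by that of
the original set. -/
theorem exists_capOpen_translate_le (hΩ : IsOpen Ω) {T : ℝ} (hT : 0 < T)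
    {α : ℝ → ℝ} (hα : ContDiff ℝ ∞ α) (hαc : HasCompactSupport α) (hαs : tsupport α ⊆ Ioo 0 T)
    (hα0 : ∀ t, 0 ≤ α t) {β : Space N → ℝ} (hβ : ContDiff ℝ ∞ β) (hβc : HasCompactSupport β)
    (hβs : tsupport β ⊆ Ω) (hβ0 : ∀ x, 0 ≤ β x) :
    ∃ δ : ℝ, 0 < δ ∧ ∃ C : ℝ≥0∞, C ≠ ⊤ ∧ ∀ y : SpaceTime N, ‖y‖ < δ →
      ∀ (U : Set (SpaceTime N)) (u : ℝ → V Ω p) (F : ℝ → VDual Ω p), MemW Ω p T u F →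
        DominatesIndicator Ω p T U u →
        capOpen Ω p T ({w | w + y ∈ U} ∩ {w | 1 < α w.1 ∧ 1 < β w.2}) ≤
          C * normW Ω p T u F := by
  obtain ⟨δ₁, hδ₁, C₁, hC₁, hshift⟩ := exists_cutoffShift_adjoint (p := p) hΩ hβ hβc hβs
  obtain ⟨δ₂, hδ₂, hshift₂⟩ := exists_pos_forall_add_mem hαc.isCompact isOpen_Ioo hαs
  obtain ⟨C₂, hC₂, hdual⟩ := exists_eLpNorm_toDual_le (Ω := Ω) (p := p) hT
  obtain ⟨A, hA⟩ := hα.continuous.bounded_above_of_compact_support hαc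
  have hdαc : Continuous (deriv α) := hα.continuous_deriv (by simp)
  obtain ⟨A', hA'⟩ := hdαc.bounded_above_of_compact_support hαc.deriv
  have hA0 : 0 ≤ A := (norm_nonneg _).trans (hA 0)
  have hA'0 : 0 ≤ A' := (norm_nonneg _).trans (hA' 0)
  refine ⟨min δ₁ δ₂, lt_min hδ₁ hδ₂,
    -- The first summand bounds $\alpha M$ on `u` and $\alpha R$ on `F`; the second bounds the
    -- product-rule term with $\alpha'$, through the embedding $W\subset L^{p'}(0,T;V')$.
    ENNReal.ofReal (A * C₁) + ENNReal.ofReal (A' * C₁) * C₂,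
    ENNReal.add_ne_top.2 ⟨ENNReal.ofReal_ne_top, ENNReal.mul_ne_top ENNReal.ofReal_ne_top hC₂⟩,
    ?_⟩
  rintro ⟨σ, z⟩ hy U u F hu hU
  obtain ⟨M, M', hM, hM', hadj, hMae⟩ := hshift z
    ((norm_snd_le (σ, z)).trans_lt (hy.trans_le (min_le_left _ _)))
  have hασ : ∀ t ∈ tsupport α, t + σ ∈ Ioo 0 T := fun t ht => hshift₂ t ht σ
    ((norm_fst_le (σ, z)).trans_lt (hy.trans_le (min_le_right _ _)))
  have hα1 : ∀ t, α t ≠ 0 → t + σ ∈ Ioo 0 T := fun t ht => hασ t (subset_tsupport _ ht)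
  have hα2 : ∀ t, deriv α t ≠ 0 → t + σ ∈ Ioo 0 T := fun t ht => hασ t <| by
    by_contra h
    exact ht (image_eq_zero_of_notMem_tsupport fun h' => h (tsupport_deriv_subset h'))
  -- Functionals are translated by transposing the adjoint `M'`; by `hadj` this extends `M` along
  -- $V\subset V'$, so it can act on $u_t$.
  let R : VDual Ω p →L[ℝ] VDual Ω p := ContinuousLinearMap.precomp ℝ M'
  have hR : ∀ f, R f = f.comp M' := fun f => rfl
  have hRn : ‖R‖ ≤ C₁ := ContinuousLinearMap.opNorm_le_bound _ hC₁ fun f => by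
    rw [hR, mul_comm]
    exact (f.opNorm_comp_le M').trans (by gcongr)
  have b1 : ∀ t, ‖α t • M‖ ≤ A * C₁ := fun t => norm_smul_clm_le hM (hA t)
  have b2 : ∀ t, ‖α t • R‖ ≤ A * C₁ := fun t => norm_smul_clm_le hRn (hA t)
  have b3 : ∀ t, ‖deriv α t • R‖ ≤ A' * C₁ := fun t => norm_smul_clm_le hRn (hA' t)
  have s1 : ∀ t, α t • M ≠ 0 → t + σ ∈ Ioo 0 T := fun t ht =>
    hα1 t (scalar_ne_zero_of_smul_clm_ne_zero ht)
  have s2 : ∀ t, α t • R ≠ 0 → t + σ ∈ Ioo 0 T := fun t ht =>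
    hα1 t (scalar_ne_zero_of_smul_clm_ne_zero ht)
  have s3 : ∀ t, deriv α t • R ≠ 0 → t + σ ∈ Ioo 0 T := fun t ht =>
    hα2 t (scalar_ne_zero_of_smul_clm_ne_zero ht)
  have c1 : Continuous fun t => α t • M := hα.continuous.smul continuous_const
  have c2 : Continuous fun t => α t • R := hα.continuous.smul continuous_const
  have c3 : Continuous fun t => deriv α t • R := hdαc.smul continuous_const
  have hdm : MemLp (fun t => toDual Ω p (u t)) (ENNReal.conjExponent p)
      (volume.restrict (Ioo 0 T)) :=
    ⟨hu.integrableOn_toDual.1, (hdual u F hu).trans_lt (ENNReal.mul_lt_top hC₂.lt_top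
      (ENNReal.add_lt_top.2 ⟨hu.memLp.2, hu.memLp_deriv.2⟩))⟩
  have m1 := memLp_weightedShift (μ := volume) (S' := Ioo 0 T) measurableSet_Ioo c1 b1 s1 hu.memLp
  have m2 := memLp_weightedShift (μ := volume) (S' := Ioo 0 T) measurableSet_Ioo c2 b2 s2
    hu.memLp_deriv
  have m3 := memLp_weightedShift (μ := volume) (S' := Ioo 0 T) measurableSet_Ioo c3 b3 s3 hdm
  have n1 := eLpNorm_weightedShift_le (μ := volume) (S' := Ioo 0 T) measurableSet_Ioo b1 s1
    hu.memLp.1 p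
  have n2 := eLpNorm_weightedShift_le (μ := volume) (S' := Ioo 0 T) measurableSet_Ioo b2 s2
    hu.memLp_deriv.1 (ENNReal.conjExponent p)
  have n3 := eLpNorm_weightedShift_le (μ := volume) (S' := Ioo 0 T) measurableSet_Ioo b3 s3
    hdm.1 (ENNReal.conjExponent p)
  have hW : MemW Ω p T (fun t => (α t • M) (u (t + σ)))
      (fun t => (deriv α t • R) (toDual Ω p (u (t + σ))) + (α t • R) (F (t + σ))) := by
    refine ⟨m1, m3.add m2, fun φ hφ hφc hφs => ?_⟩
    have := weakDeriv_cutoffShift hu.integrableOn_toDual hu.integrableOn_deriv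
      hu.isTimeDerivative hα hασ R hφ hφc hφs
    simpa only [smul_apply, toDual_smul, hadj, hR] using this
  have hD : DominatesIndicator Ω p T ({w | w + (σ, z) ∈ U} ∩ {w | 1 < α w.1 ∧ 1 < β w.2})
      (fun t => (α t • M) (u (t + σ))) := by
    refine ae_restrict_of_ae ?_
    filter_upwards [ae_shift measurableSet_Ioo hU σ] with t ht
    have hcoe : toL2 Ω p ((α t • M) (u (t + σ))) =ᵐ[volume.restrict Ω]
        fun x => α t * toL2 Ω p (M (u (t + σ))) x := by
      rw [smul_apply, map_smul]
      exact Lp.coeFn_smul _ _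
    -- If $\alpha(t)=0$, the time $t+\sigma$ may leave $(0,T)$, where nothing is known of `u`, but
    -- then no point of the localized set has time $t$. The case $\beta(x)=0$ is the same in space.
    by_cases hαt : α t = 0
    · filter_upwards [hcoe] with x hx
      rw [hx, hαt, zero_mul, indicator_of_notMem]
      rintro ⟨-, h, -⟩
      rw [hαt] at h
      linarith
    · filter_upwards [hcoe, hMae (u (t + σ)),
        ae_restrict_of_ae (ae_shift hΩ.measurableSet (ht (hα1 t hαt)) z)] with x hx hx1 hx2
      rw [hx, hx1.2]
      by_cases hβx : β x = 0
      · rw [hβx, zero_mul, mul_zero, indicator_of_notMem]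
        rintro ⟨-, -, h⟩
        rw [hβx] at h
        linarith
      · have h2 := hx2 (hx1.1 hβx)
        have h3 : 0 ≤ toL2 Ω p (u (t + σ)) (x + z) :=
          (indicator_nonneg (fun _ _ => zero_le_one) _).trans h2
        by_cases hmem : (t, x) ∈ {w | w + (σ, z) ∈ U} ∩ {w | 1 < α w.1 ∧ 1 < β w.2}
        · rw [indicator_of_mem hmem]
          have hxU : (t + σ, x + z) ∈ U := hmem.1
          rw [indicator_of_mem hxU] at h2
          exact one_le_mul_of_one_le_of_one_le hmem.2.1.le
            (one_le_mul_of_one_le_of_one_le hmem.2.2.le h2)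
        · rw [indicator_of_notMem hmem]
          exact mul_nonneg (hα0 t) (mul_nonneg (hβ0 x) h3)
  refine (iInf₂_le_of_le _ _ (iInf₂_le_of_le hW hD le_rfl)).trans ?_
  have n4 := (eLpNorm_add_le m3.1 m2.1 (one_le_conjExponent p)).trans (add_le_add n3 n2)
  refine (add_le_add n1 n4).trans ?_
  calc _ ≤ ENNReal.ofReal (A * C₁) * eLpNorm u p (volume.restrict (Ioo 0 T)) +
        (ENNReal.ofReal (A' * C₁) * (C₂ * normW Ω p T u F) + ENNReal.ofReal (A * C₁) *
          eLpNorm F (ENNReal.conjExponent p) (volume.restrict (Ioo 0 T))) := by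
        gcongr
        exact hdual u F hu
    _ = _ := by
        simp only [normW]
        ring

end CapacityTranslation

/-! ### Completeness of $V$ and countable subadditivity. -/

section Subadditivity

variable {N : ℕ} {Ω : Set (Space N)} {p : ℝ≥0∞} [Fact (1 ≤ p)]

/-- Convergence in $L^p$ and in $L^2$ both imply convergence in measure, whose limit is unique
almost everywhere. The resulting completeness of $V$ allows series of competitors to be summed. -/
theorem isClosed_sobolevV :
    IsClosed (sobolevV Ω p : Set (WithLp 1 (W01p Ω p × Lp ℝ 2 (volume.restrict Ω)))) := by
  refine IsSeqClosed.isClosed fun w w₀ hw hlim => ?_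
  have h1 : Filter.Tendsto (fun n => (w n).fst.1.fst) Filter.atTop (nhds w₀.fst.1.fst) :=
    (((WithLp.fstL 1 ℝ (Lp ℝ p (volume.restrict Ω)) (Lp (Space N) p (volume.restrict Ω))).comp
      ((W01p Ω p).subtypeL.comp
        (WithLp.fstL 1 ℝ (W01p Ω p) (Lp ℝ 2 (volume.restrict Ω))))).continuous.tendsto w₀).comp hlim
  have h2 : Filter.Tendsto (fun n => (w n).snd) Filter.atTop (nhds w₀.snd) :=
    ((WithLp.sndL 1 ℝ (W01p Ω p) (Lp ℝ 2 (volume.restrict Ω))).continuous.tendsto w₀).comp hlim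
  have m1 := tendstoInMeasure_of_tendsto_Lp h1
  have m2 := tendstoInMeasure_of_tendsto_Lp h2
  exact tendstoInMeasure_ae_unique (m1.congr_left fun n => hw n) m2

instance : CompleteSpace (W01p Ω p) :=
  (Submodule.isClosed_topologicalClosure (testPairs Ω p)).completeSpace_coe

instance : CompleteSpace (V Ω p) :=
  (isClosed_sobolevV (Ω := Ω) (p := p)).completeSpace_coe

/-- Used to pass the identity defining $u_t$ to a series. Hölder on the bounded interval turns
summable $L^q$ norms into summable $L^1$ norms, which justifies exchanging sum and integral. -/
theorem hasSum_setIntegral_smul {E E' : Type*} [NormedAddCommGroup E] [NormedSpace ℝ E]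
    [NormedAddCommGroup E'] [NormedSpace ℝ E'] [CompleteSpace E'] {T : ℝ}
    {q : ℝ≥0∞} (hq : 1 ≤ q) {k : ℝ → ℝ} (hk : Continuous k) {c : ℝ} (hc : ∀ t, ‖k t‖ ≤ c)
    (R : E →L[ℝ] E') {f : ℕ → ℝ → E} (hf : ∀ n, MemLp (f n) q (volume.restrict (Ioo 0 T)))
    (hsum : ∑' n, eLpNorm (f n) q (volume.restrict (Ioo 0 T)) ≠ ⊤) {s : ℝ → E}
    (hs : ∀ᵐ t ∂(volume.restrict (Ioo 0 T)), HasSum (fun n => f n t) (s t)) :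
    HasSum (fun n => ∫ t in Ioo 0 T, k t • R (f n t)) (∫ t in Ioo 0 T, k t • R (s t)) := by
  obtain ⟨C, hC, hC'⟩ := eLpNorm_one_restrict_Ioo_le (E := E) T hq
  have hi : ∀ n, Integrable (fun t => k t • R (f n t)) (volume.restrict (Ioo 0 T)) := fun n =>
    (R.integrable_comp ((hf n).integrable hq)).bdd_smul c hk.aestronglyMeasurable
      (Filter.Eventually.of_forall hc)
  have hb : ∀ n, ∫⁻ t in Ioo 0 T, ‖k t • R (f n t)‖ₑ ≤
      ENNReal.ofReal (c * ‖R‖) * (C * eLpNorm (f n) q (volume.restrict (Ioo 0 T))) := fun n => by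
    rw [← eLpNorm_one_eq_lintegral_enorm]
    refine (eLpNorm_le_mul_eLpNorm_of_ae_le_mul (g := f n) (c := c * ‖R‖)
      (Filter.Eventually.of_forall fun t => ?_) 1).trans ?_
    · exact (k t • R).le_of_opNorm_le (norm_smul_clm_le le_rfl (hc t)) (f n t)
    · gcongr
      exact hC' _ (hf n).1
  have key := hasSum_integral_of_summable_integral_norm hi (by
    simp_rw [integral_norm_eq_lintegral_enorm (hi _).1]
    refine ENNReal.summable_toReal (ne_top_of_le_ne_top ?_ (ENNReal.tsum_le_tsum hb))
    rw [ENNReal.tsum_mul_left, ENNReal.tsum_mul_left]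
    exact ENNReal.mul_ne_top ENNReal.ofReal_ne_top (ENNReal.mul_ne_top hC hsum))
  have heq : ∫ t in Ioo 0 T, ∑' n, k t • R (f n t) = ∫ t in Ioo 0 T, k t • R (s t) := by
    refine integral_congr_ae (hs.mono fun t ht => ?_)
    exact ((ht.mapL R).const_smul (k t)).tsum_eq
  rwa [heq] at key

/-- Countable subadditivity of the capacity of open sets, on the level of competitors. -/
theorem capOpen_iUnion_le {T : ℝ} {U : ℕ → Set (SpaceTime N)} {u : ℕ → ℝ → V Ω p}
    {F : ℕ → ℝ → VDual Ω p} (hu : ∀ n, MemW Ω p T (u n) (F n))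
    (hU : ∀ n, DominatesIndicator Ω p T (U n) (u n))
    (hsum : ∑' n, normW Ω p T (u n) (F n) ≠ ⊤) :
    capOpen Ω p T (⋃ n, U n) ≤ ∑' n, normW Ω p T (u n) (F n) := by
  have : Fact (1 ≤ ENNReal.conjExponent p) := ⟨one_le_conjExponent p⟩
  have hsplit := hsum
  simp only [normW] at hsplit
  rw [ENNReal.tsum_add, ENNReal.add_ne_top] at hsplit
  obtain ⟨hs1, hs2⟩ := hsplit
  let f : ℕ → Lp (V Ω p) p (volume.restrict (Ioo 0 T)) := fun n => (hu n).memLp.toLp _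
  let G : ℕ → Lp (VDual Ω p) (ENNReal.conjExponent p) (volume.restrict (Ioo 0 T)) := fun n =>
    (hu n).memLp_deriv.toLp _
  have hf : ∀ n, ‖f n‖ₑ = eLpNorm (u n) p (volume.restrict (Ioo 0 T)) := fun n =>
    Lp.enorm_toLp _
  have hG : ∀ n, ‖G n‖ₑ = eLpNorm (F n) (ENNReal.conjExponent p) (volume.restrict (Ioo 0 T)) :=
    fun n => Lp.enorm_toLp _
  have hf1 : ∑' n, ‖f n‖ₑ ≠ ⊤ := by simpa only [hf] using hs1
  have hG1 : ∑' n, ‖G n‖ₑ ≠ ⊤ := by simpa only [hG] using hs2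
  have hfae : ∀ᵐ t ∂(volume.restrict (Ioo 0 T)),
      HasSum (fun n => u n t) ((∑' n, f n : Lp (V Ω p) p (volume.restrict (Ioo 0 T))) t) := by
    filter_upwards [Lp.hasSum_coeFn_tsum hf1,
      ae_all_iff.2 fun n => (hu n).memLp.coeFn_toLp] with t ht ht'
    simpa only [f, ht'] using ht
  have hGae : ∀ᵐ t ∂(volume.restrict (Ioo 0 T)),
      HasSum (fun n => F n t) ((∑' n, G n :
        Lp (VDual Ω p) (ENNReal.conjExponent p) (volume.restrict (Ioo 0 T))) t) := by
    filter_upwards [Lp.hasSum_coeFn_tsum hG1,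
      ae_all_iff.2 fun n => (hu n).memLp_deriv.coeFn_toLp] with t ht ht'
    simpa only [G, ht'] using ht
  have hW : MemW Ω p T (∑' n, f n : Lp (V Ω p) p (volume.restrict (Ioo 0 T)))
      (∑' n, G n : Lp (VDual Ω p) (ENNReal.conjExponent p) (volume.restrict (Ioo 0 T))) := by
    refine ⟨Lp.memLp _, Lp.memLp _, fun φ hφ hφc hφs => ?_⟩
    have hdφ : Continuous (deriv φ) := hφ.continuous_deriv (by simp)
    obtain ⟨c, hc⟩ := hφ.continuous.bounded_above_of_compact_support hφc
    obtain ⟨c', hc'⟩ := hdφ.bounded_above_of_compact_support hφc.deriv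
    have k1 := hasSum_setIntegral_smul (Fact.out : 1 ≤ p) hdφ hc' (toDualL Ω p)
      (fun n => (hu n).memLp) hs1 hfae
    have k2 := hasSum_setIntegral_smul (one_le_conjExponent p) hφ.continuous hc
      (ContinuousLinearMap.id ℝ (VDual Ω p)) (fun n => (hu n).memLp_deriv) hs2 hGae
    have k3 : HasSum (fun n => -∫ t in Ioo 0 T, φ t • F n t) (-∫ t in Ioo 0 T, φ t •
        (∑' n, G n : Lp (VDual Ω p) (ENNReal.conjExponent p) (volume.restrict (Ioo 0 T))) t) :=
      k2.neg
    rw [← funext fun n => (hu n).isTimeDerivative φ hφ hφc hφs] at k3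
    exact k1.unique k3
  have hD : DominatesIndicator Ω p T (⋃ n, U n)
      (∑' n, f n : Lp (V Ω p) p (volume.restrict (Ioo 0 T))) := by
    filter_upwards [hfae, ae_all_iff.2 hU] with t ht htU
    -- Dominating an indicator forces each competitor to be nonnegative, so the sum dominates every
    -- term; no lattice property of $W$ is needed.
    have h0 : ∀ n, 0 ≤ toL2 Ω p (u n t) := fun n => by
      rw [← Lp.coeFn_nonneg]
      filter_upwards [htU n] with x hx
      exact (indicator_nonneg (fun _ _ => zero_le_one) _).trans hx
    have hle : ∀ n, toL2 Ω p (u n t) ≤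
        toL2 Ω p ((∑' n, f n : Lp (V Ω p) p (volume.restrict (Ioo 0 T))) t) := fun n =>
      le_hasSum (ht.mapL (toL2 Ω p)) n fun m _ => h0 m
    filter_upwards [ae_all_iff.2 htU, ae_all_iff.2 fun n => (Lp.coeFn_le _ _).2 (hle n)]
      with x hx hx'
    by_cases hmem : (t, x) ∈ ⋃ n, U n
    · obtain ⟨n, hn⟩ := mem_iUnion.1 hmem
      have := (hx n).trans (hx' n)
      rw [indicator_of_mem hn] at this
      exact (indicator_of_mem hmem _).trans_le this
    · rw [indicator_of_notMem hmem]
      exact ((indicator_nonneg (fun _ _ => zero_le_one) _).trans (hx 0)).trans (hx' 0)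
  refine (iInf₂_le_of_le _ _ (iInf₂_le_of_le hW hD le_rfl)).trans ?_
  simp only [normW]
  rw [ENNReal.tsum_add, ← Lp.enorm_def, ← Lp.enorm_def]
  simp only [← hf, ← hG]
  exact add_le_add enorm_tsum_le_tsum_enorm enorm_tsum_le_tsum_enorm

end Subadditivity

/-! ### Absolute continuity of measures with respect to capacity. -/

section Diffuse

variable {N : ℕ} {Ω : Set (Space N)} {p : ℝ≥0∞} [Fact (1 ≤ p)]

theorem cap_mono (T : ℝ) {A B : Set (SpaceTime N)} (h : A ⊆ B) : cap Ω p T A ≤ cap Ω p T B :=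
  iInf_mono fun _ => iInf_mono fun _ => iInf_mono' fun hB => ⟨h.trans hB, le_rfl⟩

theorem cap_le_capOpen {T : ℝ} {A U : Set (SpaceTime N)} (hU : IsOpen U) (hA : A ⊆ U)
    (hUQ : U ⊆ cylinder Ω T) : cap Ω p T A ≤ capOpen Ω p T U :=
  iInf₂_le_of_le U hU (iInf₂_le_of_le hA hUQ le_rfl)

theorem exists_competitor_of_capOpen_lt {T : ℝ} {U : Set (SpaceTime N)} {r : ℝ≥0∞}
    (h : capOpen Ω p T U < r) : ∃ (u : ℝ → V Ω p) (F : ℝ → VDual Ω p),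
      MemW Ω p T u F ∧ DominatesIndicator Ω p T U u ∧ normW Ω p T u F < r := by
  simp only [capOpen, iInf_lt_iff] at h
  obtain ⟨u, F, hu, hU, hr⟩ := h
  exact ⟨u, F, hu, hU, hr⟩

theorem exists_open_of_cap_lt {T : ℝ} {A : Set (SpaceTime N)} {r : ℝ≥0∞}
    (h : cap Ω p T A < r) : ∃ U, IsOpen U ∧ A ⊆ U ∧ U ⊆ cylinder Ω T ∧ capOpen Ω p T U < r := by
  simp only [cap, iInf_lt_iff] at h
  obtain ⟨U, hU, hA, hUQ, hr⟩ := h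
  exact ⟨U, hU, hA, hUQ, hr⟩

/-- Vanishing of `μ E` alone would allow cancellation; monotonicity of the capacity makes every
measurable subset of `E` null as well. -/
theorem IsDiffuse.totalVariation_eq_zero {T : ℝ} {μ : SignedMeasure (SpaceTime N)}
    (hμ : IsDiffuse Ω p T μ) {E : Set (SpaceTime N)} (hE : MeasurableSet E)
    (hEQ : E ⊆ cylinder Ω T) (hcap : cap Ω p T E = 0) : μ.totalVariation E = 0 := by
  rw [SignedMeasure.totalVariation_eq_variation, VectorMeasure.variation_apply_eq_zero hE]
  exact fun t htE ht => hμ.null t ht (htE.trans hEQ)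
    (le_antisymm ((cap_mono T htE).trans_eq hcap) zero_le)

/-- A finite measure vanishing on the sets of zero capacity is absolutely continuous with respect
to the capacity. -/
theorem exists_forall_capOpen_lt_measure_lt {T : ℝ} {m : Measure (SpaceTime N)}
    [IsFiniteMeasure m] (hm : ∀ E, MeasurableSet E → E ⊆ cylinder Ω T → cap Ω p T E = 0 → m E = 0)
    {ε : ℝ≥0∞} (hε : ε ≠ 0) :
    ∃ η : ℝ≥0∞, η ≠ 0 ∧ ∀ U : Set (SpaceTime N), IsOpen U → U ⊆ cylinder Ω T →
      capOpen Ω p T U < η → m U < ε := by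
  by_contra! hcon
  have h1 : ∀ n : ℕ, ∃ U : Set (SpaceTime N), IsOpen U ∧ U ⊆ cylinder Ω T ∧
      capOpen Ω p T U < 2⁻¹ ^ n ∧ ε ≤ m U := fun n =>
    hcon (2⁻¹ ^ n) (pow_ne_zero _ (by simp))
  choose U hUo hUQ hUc hUε using h1
  choose u F hu hD hn using fun n => exists_competitor_of_capOpen_lt (hUc n)
  -- Tails whose intersection is the limsup: the geometric series bounds the capacity of `A k` by
  -- $2\cdot2^{-k}$, while each has measure at least $\varepsilon$.
  let A : ℕ → Set (SpaceTime N) := fun k => ⋃ n, U (n + k)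
  have hAo : ∀ k, IsOpen (A k) := fun k => isOpen_iUnion fun n => hUo _
  have hAQ : ∀ k, A k ⊆ cylinder Ω T := fun k => iUnion_subset fun n => hUQ _
  have hAcap : ∀ k, capOpen Ω p T (A k) ≤ 2⁻¹ ^ k * 2 := fun k => by
    have hle : ∑' n, normW Ω p T (u (n + k)) (F (n + k)) ≤ 2⁻¹ ^ k * 2 := by
      refine (ENNReal.tsum_le_tsum fun n => (hn (n + k)).le).trans_eq ?_
      simp_rw [pow_add]
      rw [ENNReal.tsum_mul_right, ENNReal.tsum_geometric, mul_comm]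
      simp
    refine (capOpen_iUnion_le (fun n => hu (n + k)) (fun n => hD (n + k)) ?_).trans hle
    exact ne_top_of_le_ne_top (ENNReal.mul_ne_top (ENNReal.pow_ne_top (by simp)) (by simp)) hle
  have hanti : Antitone A := antitone_nat_of_succ_le fun k => iUnion_subset fun n =>
    (subset_iUnion (fun n => U (n + k)) (n + 1)).trans' (by
      rw [show n + (k + 1) = n + 1 + k by ring])
  have hAm : MeasurableSet (⋂ k, A k) := MeasurableSet.iInter fun k => (hAo k).measurableSet
  have hzero : m (⋂ k, A k) = 0 := by
    refine hm _ hAm ((iInter_subset _ 0).trans (hAQ 0)) (le_antisymm ?_ zero_le)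
    have hlim : Filter.Tendsto (fun k : ℕ => (2⁻¹ : ℝ≥0∞) ^ k * 2) Filter.atTop (nhds 0) := by
      have := ENNReal.Tendsto.mul_const (b := 2)
        (ENNReal.tendsto_pow_atTop_nhds_zero_of_lt_one (r := 2⁻¹) (by simp)) (Or.inr (by simp))
      simpa using this
    exact ge_of_tendsto' hlim fun k =>
      (cap_le_capOpen (hAo k) (iInter_subset _ k) (hAQ k)).trans (hAcap k)
  rw [hanti.measure_iInter (fun k => (hAo k).measurableSet.nullMeasurableSet)
    ⟨0, measure_ne_top _ _⟩] at hzero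
  refine hε (le_antisymm (hzero ▸ le_iInf fun k => (hUε k).trans (measure_mono ?_)) zero_le)
  exact (subset_iUnion (fun n => U (n + k)) 0).trans' (by rw [zero_add])

/-- Lebesgue measure is controlled by the capacity. -/
theorem exists_volume_le_normW (hΩb : Bornology.IsBounded Ω) (T : ℝ) :
    ∃ C : ℝ≥0∞, C ≠ ⊤ ∧ ∀ U : Set (SpaceTime N), MeasurableSet U → U ⊆ cylinder Ω T →
      ∀ (u : ℝ → V Ω p) (F : ℝ → VDual Ω p), MemW Ω p T u F → DominatesIndicator Ω p T U u →
        volume U ≤ C * normW Ω p T u F := by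
  obtain ⟨C, hC, hC'⟩ := eLpNorm_one_restrict_Ioo_le (E := V Ω p) T (q := p) Fact.out
  set c : ℝ≥0∞ := volume.restrict Ω univ ^ (1 / (1 : ℝ≥0∞).toReal - 1 / (2 : ℝ≥0∞).toReal)
  have hc : c ≠ ⊤ := by
    refine ENNReal.rpow_ne_top_of_nonneg (by norm_num) ?_
    rw [Measure.restrict_apply_univ]
    exact hΩb.measure_lt_top.ne
  refine ⟨c * C, ENNReal.mul_ne_top hc hC, fun U hU hUQ u F hu hD => ?_⟩
  -- On a slice of `U` one has $u\ge1$, so its measure is at most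
  -- $\int_\Omega|u(t)|\le|\Omega|^{1/2}\|u(t)\|_{L^2}$; integrating in $t$ gives the bound.
  have hslice : ∀ᵐ t ∂(volume : Measure ℝ), volume (Prod.mk t ⁻¹' U) ≤
      (Ioo 0 T).indicator (fun t => c * ‖u t‖ₑ) t := by
    filter_upwards [(ae_restrict_iff' measurableSet_Ioo).1 hD] with t ht
    by_cases htT : t ∈ Ioo 0 T
    · rw [indicator_of_mem htT]
      have hsub : Prod.mk t ⁻¹' U ⊆ Ω := fun x hx => (hUQ hx).2
      have hUt : MeasurableSet (Prod.mk t ⁻¹' U) := measurable_prodMk_left hU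
      calc volume (Prod.mk t ⁻¹' U)
          = volume.restrict Ω (Prod.mk t ⁻¹' U) := by
            rw [Measure.restrict_apply hUt, inter_eq_left.2 hsub]
        _ = ∫⁻ x in Ω, (Prod.mk t ⁻¹' U).indicator 1 x := (lintegral_indicator_one hUt).symm
        _ ≤ ∫⁻ x in Ω, ‖toL2 Ω p (u t) x‖ₑ := by
            refine lintegral_mono_ae ((ht htT).mono fun x hx => ?_)
            by_cases hxU : (t, x) ∈ U
            · rw [indicator_of_mem hxU] at hx
              rw [indicator_of_mem (s := Prod.mk t ⁻¹' U) hxU, Pi.one_apply,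
                ← ofReal_norm, ← ENNReal.ofReal_one]
              exact ENNReal.ofReal_le_ofReal (hx.trans (Real.le_norm_self _))
            · rw [indicator_of_notMem (s := Prod.mk t ⁻¹' U) hxU]
              exact zero_le
        _ = eLpNorm (toL2 Ω p (u t)) 1 (volume.restrict Ω) := eLpNorm_one_eq_lintegral_enorm.symm
        _ ≤ eLpNorm (toL2 Ω p (u t)) 2 (volume.restrict Ω) * c :=
            eLpNorm_le_eLpNorm_mul_rpow_measure_univ (by norm_num) (Lp.aestronglyMeasurable _)
        _ ≤ c * ‖u t‖ₑ := by
            rw [mul_comm, ← Lp.enorm_def]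
            gcongr
            exact enorm_le_iff_norm_le.2 (norm_toL2_le _)
    · have : Prod.mk t ⁻¹' U = ∅ := eq_empty_of_forall_notMem fun x hx => htT (hUQ hx).1
      rw [this, measure_empty]
      exact zero_le
  rw [Measure.volume_eq_prod, Measure.prod_apply hU]
  refine (lintegral_mono_ae hslice).trans ?_
  rw [lintegral_indicator measurableSet_Ioo, lintegral_const_mul' _ _ hc,
    ← eLpNorm_one_eq_lintegral_enorm, mul_assoc]
  gcongr
  refine (hC' u hu.memLp.1).trans ?_
  gcongr
  exact le_self_add

end Diffuse

/-! ### Total variation of a mollified measure, and cutoffs. -/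

section ConvolutionBounds

variable {N : ℕ} {Ω : Set (Space N)}

instance (μ : SignedMeasure (SpaceTime N)) : IsFiniteMeasure μ.totalVariation := by
  unfold SignedMeasure.totalVariation
  infer_instance

theorem enorm_conv_le (T : ℝ) (ρ : SpaceTime N → ℝ) (μ : SignedMeasure (SpaceTime N))
    (z : SpaceTime N) : ‖conv Ω T ρ μ z‖ₑ ≤ ∫⁻ w, ‖ρ (z - w)‖ₑ ∂μ.totalVariation := by
  rw [SignedMeasure.totalVariation, lintegral_add_measure]
  refine (enorm_sub_le).trans (add_le_add ?_ ?_)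
  · exact (enorm_integral_le_lintegral_enorm _).trans (setLIntegral_le_lintegral _ _)
  · exact (enorm_integral_le_lintegral_enorm _).trans (setLIntegral_le_lintegral _ _)

theorem totalVariation_convMeasure_le (hΩb : Bornology.IsBounded Ω) (T : ℝ)
    {ρ : SpaceTime N → ℝ} (hρ : Continuous ρ) (hc : HasCompactSupport ρ)
    (μ : SignedMeasure (SpaceTime N)) {E : Set (SpaceTime N)} (hE : MeasurableSet E) :
    (convMeasure Ω T ρ μ).totalVariation E ≤
      ∫⁻ z in E, ∫⁻ w, ‖ρ (z - w)‖ₑ ∂μ.totalVariation := by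
  rw [SignedMeasure.totalVariation_eq_variation, convMeasure,
    Measure.variation_withDensityᵥ (integrable_conv hΩb T hρ hc μ), withDensity_apply _ hE,
    Measure.restrict_restrict hE]
  exact (lintegral_mono_set inter_subset_left).trans
    (lintegral_mono fun z => enorm_conv_le T ρ μ z)

/-- Tonelli and the substitution $z=w+y$ exchange smoothing the measure for averaging its values on
translates of the set. -/
theorem totalVariation_convMeasure_le_translates (hΩb : Bornology.IsBounded Ω) (T : ℝ)
    {ρ : SpaceTime N → ℝ} (hρ : Continuous ρ) (hc : HasCompactSupport ρ)
    (μ : SignedMeasure (SpaceTime N)) {E : Set (SpaceTime N)} (hE : MeasurableSet E) :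
    (convMeasure Ω T ρ μ).totalVariation E ≤
      ∫⁻ y, ‖ρ y‖ₑ * μ.totalVariation {w | w + y ∈ E} := by
  refine (totalVariation_convMeasure_le hΩb T hρ hc μ hE).trans_eq ?_
  have hinv : (volume : Measure (SpaceTime N)).IsAddLeftInvariant :=
    inferInstanceAs ((volume : Measure ℝ).prod (volume : Measure (Space N))).IsAddLeftInvariant
  have hmeas : Measurable fun q : SpaceTime N × SpaceTime N =>
      E.indicator (fun _ => (1 : ℝ≥0∞)) (q.2 + q.1) * ‖ρ q.1‖ₑ :=
    ((measurable_const.indicator hE).comp (measurable_snd.add measurable_fst)).mul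
      (hρ.measurable.comp measurable_fst).enorm
  have hmeas' : Measurable fun q : SpaceTime N × SpaceTime N => ‖ρ (q.1 - q.2)‖ₑ :=
    (hρ.measurable.comp (measurable_fst.sub measurable_snd)).enorm
  calc ∫⁻ z in E, ∫⁻ w, ‖ρ (z - w)‖ₑ ∂μ.totalVariation
      = ∫⁻ w, (∫⁻ z in E, ‖ρ (z - w)‖ₑ) ∂μ.totalVariation :=
        lintegral_lintegral_swap hmeas'.aemeasurable
    _ = ∫⁻ w, (∫⁻ y, E.indicator (fun _ => (1 : ℝ≥0∞)) (w + y) * ‖ρ y‖ₑ) ∂μ.totalVariation := by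
        refine lintegral_congr fun w => ?_
        rw [← lintegral_indicator hE, ← lintegral_add_left_eq_self _ w]
        refine lintegral_congr fun y => ?_
        by_cases h : w + y ∈ E <;> simp [h]
    _ = ∫⁻ y, ∫⁻ w, E.indicator (fun _ => (1 : ℝ≥0∞)) (w + y) * ‖ρ y‖ₑ ∂μ.totalVariation :=
        (lintegral_lintegral_swap hmeas.aemeasurable).symm
    _ = ∫⁻ y, ‖ρ y‖ₑ * μ.totalVariation {w | w + y ∈ E} := by
        refine lintegral_congr fun y => ?_
        have hy : MeasurableSet {w | w + y ∈ E} := measurable_add_const y hE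
        rw [lintegral_mul_const' _ _ enorm_ne_top, mul_comm, ← lintegral_indicator_one hy]
        rfl

/-- Meant for the finitely many mollifiers whose support is too wide for the translation argument;
the constant depends on $\rho$. -/
theorem exists_totalVariation_convMeasure_le_volume (hΩb : Bornology.IsBounded Ω) (T : ℝ)
    {ρ : SpaceTime N → ℝ} (hρ : Continuous ρ) (hc : HasCompactSupport ρ)
    (μ : SignedMeasure (SpaceTime N)) :
    ∃ C : ℝ≥0∞, C ≠ ⊤ ∧ ∀ E : Set (SpaceTime N), MeasurableSet E →
      (convMeasure Ω T ρ μ).totalVariation E ≤ C * volume E := by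
  obtain ⟨c, hc'⟩ := hρ.bounded_above_of_compact_support hc
  refine ⟨ENNReal.ofReal c * μ.totalVariation univ,
    ENNReal.mul_ne_top ENNReal.ofReal_ne_top (measure_ne_top _ _), fun E hE => ?_⟩
  refine (totalVariation_convMeasure_le hΩb T hρ hc μ hE).trans ?_
  calc ∫⁻ z in E, ∫⁻ w, ‖ρ (z - w)‖ₑ ∂μ.totalVariation
      ≤ ∫⁻ _ in E, ∫⁻ _, ENNReal.ofReal c ∂μ.totalVariation := by
        refine lintegral_mono fun z => lintegral_mono fun w => ?_
        rw [← ofReal_norm]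
        exact ENNReal.ofReal_le_ofReal (hc' _)
    _ = ENNReal.ofReal c * μ.totalVariation univ * volume E := by simp

/-- Doubling a bump equal to $1$ on `K` makes $\{f>1\}$ an open neighbourhood of `K`. -/
theorem exists_contDiff_cutoff {X : Type*} [NormedAddCommGroup X] [NormedSpace ℝ X]
    [FiniteDimensional ℝ X] {K U : Set X} (hK : IsCompact K) (hU : IsOpen U) (hKU : K ⊆ U) :
    ∃ f : X → ℝ, ContDiff ℝ ∞ f ∧ HasCompactSupport f ∧ tsupport f ⊆ U ∧ (∀ x, 0 ≤ f x) ∧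
      ∀ x ∈ K, 1 < f x := by
  obtain ⟨L, hL, hKL, hLU⟩ := exists_compact_between hK hU hKU
  obtain ⟨f, hf, hr, hs, h1⟩ := exists_contMDiff_support_eq_eq_one_iff (n := ⊤)
    (modelWithCornersSelf ℝ X) isOpen_interior hK.isClosed hKL
  have hts : tsupport (fun x => 2 * f x) ⊆ L := by
    refine closure_minimal (fun x hx => interior_subset (hs ▸ ?_)) hL.isClosed
    exact right_ne_zero_of_mul hx
  refine ⟨fun x => 2 * f x, contDiff_const.mul hf.contDiff,
    hL.of_isClosed_subset isClosed_closure hts, hts.trans hLU,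
    fun x => mul_nonneg zero_le_two (hr (mem_range_self x)).1, fun x hx => ?_⟩
  change 1 < 2 * f x
  rw [(h1 x).1 hx]
  norm_num

end ConvolutionBounds

theorem mul_lt_of_lt_div_add_one {D ε x : ℝ≥0∞} (h : x < ε / (D + 1)) :
    D * x < ε :=
  (mul_le_mul_left le_self_add x).trans_lt
    (ENNReal.mul_lt_of_lt_div' h)

/-! ### Smallness on translates, and its transfer to mollifications. -/

section Equidiffuse

variable {N : ℕ} {Ω : Set (Space N)} {p : ℝ≥0∞} [Fact (1 ≤ p)]

/-- A diffuse measure charges little the small translates of a set of small capacity. -/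
theorem exists_translate_measure_lt (hΩ : IsOpen Ω) {T : ℝ} (hT : 0 < T)
    {μ : SignedMeasure (SpaceTime N)} (hμ : IsDiffuse Ω p T μ) {ε : ℝ≥0∞} (hε : ε ≠ 0) :
    ∃ δ : ℝ, 0 < δ ∧ ∃ η : ℝ≥0∞, η ≠ 0 ∧ ∀ y : SpaceTime N, ‖y‖ < δ →
      ∀ U : Set (SpaceTime N), IsOpen U → ∀ (u : ℝ → V Ω p) (F : ℝ → VDual Ω p),
        MemW Ω p T u F → DominatesIndicator Ω p T U u → normW Ω p T u F < η →
        μ.totalVariation {w | w + y ∈ U} < ε := by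
  have hε2 : ε / 2 ≠ 0 := by simpa using hε
  have hQ : IsOpen (cylinder Ω T) := isOpen_Ioo.prod hΩ
  -- Half of `ε` pays for the mass off `K`, where translates are not controlled; the other half is
  -- for the localized translate.
  obtain ⟨K, hKQ, hK, hKε⟩ := hQ.measurableSet.exists_isCompact_sdiff_lt
    (μ := μ.totalVariation) (measure_ne_top _ _) hε2
  obtain ⟨α, hα, hαc, hαs, hα0, hα1⟩ := exists_contDiff_cutoff (hK.image continuous_fst)
    (isOpen_Ioo (a := (0 : ℝ)) (b := T)) (image_subset_iff.2 fun w hw => (hKQ hw).1)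
  obtain ⟨β, hβ, hβc, hβs, hβ0, hβ1⟩ := exists_contDiff_cutoff (hK.image continuous_snd) hΩ
    (image_subset_iff.2 fun w hw => (hKQ hw).2)
  obtain ⟨δ, hδ, C, hC, htrans⟩ :=
    exists_capOpen_translate_le (p := p) hΩ hT hα hαc hαs hα0 hβ hβc hβs hβ0
  obtain ⟨η, hη, hac⟩ := exists_forall_capOpen_lt_measure_lt
    (fun E hE hEQ h => hμ.totalVariation_eq_zero hE hEQ h) hε2
  set O : Set (SpaceTime N) := {w | 1 < α w.1 ∧ 1 < β w.2}
  have hO : IsOpen O := (isOpen_lt continuous_const (hα.continuous.comp continuous_fst)).inter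
    (isOpen_lt continuous_const (hβ.continuous.comp continuous_snd))
  have hOQ : O ⊆ cylinder Ω T := fun w hw =>
    ⟨hαs (subset_tsupport _ (zero_lt_one.trans hw.1).ne'),
      hβs (subset_tsupport _ (zero_lt_one.trans hw.2).ne')⟩
  have hOc : μ.totalVariation Oᶜ < ε / 2 := by
    have hsub : Oᶜ ⊆ (cylinder Ω T \ K) ∪ (cylinder Ω T)ᶜ := fun w hw => by
      by_cases hwQ : w ∈ cylinder Ω T
      · exact Or.inl ⟨hwQ, fun hwK =>
          hw ⟨hα1 _ (mem_image_of_mem _ hwK), hβ1 _ (mem_image_of_mem _ hwK)⟩⟩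
      · exact Or.inr hwQ
    refine (measure_mono hsub).trans_lt ((measure_union_le _ _).trans_lt ?_)
    rwa [hμ.carried, add_zero]
  -- The division absorbs the constant `C` lost in translating the competitor.
  refine ⟨δ, hδ, η / (C + 1), ?_, fun y hy U hU u F hu hD hn => ?_⟩
  · exact (ENNReal.div_pos hη (ENNReal.add_ne_top.2 ⟨hC, ENNReal.one_ne_top⟩)).ne'
  have hUy : IsOpen {w : SpaceTime N | w + y ∈ U} := hU.preimage (continuous_add_const y)
  have h1 := hac _ (hUy.inter hO) (inter_subset_right.trans hOQ)
    ((htrans y hy U u F hu hD).trans_lt (mul_lt_of_lt_div_add_one hn))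
  calc μ.totalVariation {w | w + y ∈ U}
      ≤ μ.totalVariation ({w | w + y ∈ U} ∩ O) + μ.totalVariation Oᶜ := by
        refine (measure_mono fun w hw => ?_).trans (measure_union_le _ _)
        by_cases hwO : w ∈ O
        · exact Or.inl ⟨hw, hwO⟩
        · exact Or.inr hwO
    _ < ε / 2 + ε / 2 := ENNReal.add_lt_add h1 hOc
    _ = ε := ENNReal.add_halves ε

theorem IsMollifierSeq.totalVariation_convMeasure_le_of_translates (hΩb : Bornology.IsBounded Ω)
    (T : ℝ) {ρ : ℕ → SpaceTime N → ℝ} (hρ : IsMollifierSeq ρ) {n : ℕ} (hn : 1 ≤ n)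
    (μ : SignedMeasure (SpaceTime N)) {E : Set (SpaceTime N)} (hE : MeasurableSet E) {ε : ℝ≥0∞}
    (h : ∀ y : SpaceTime N, ‖y‖ < 1 / (n : ℝ) → μ.totalVariation {w | w + y ∈ E} ≤ ε) :
    (convMeasure Ω T (ρ n) μ).totalVariation E ≤ ε := by
  have hcont := (hρ.smooth n hn).continuous
  have hint : Integrable (ρ n) := hcont.integrable_of_hasCompactSupport (hρ.compactSupport n hn)
  have hone : ∫⁻ y, ‖ρ n y‖ₑ = 1 := by
    rw [← ofReal_integral_norm_eq_lintegral_enorm hint]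
    simp_rw [Real.norm_of_nonneg (hρ.nonneg n hn _)]
    rw [hρ.integral_eq_one n hn, ENNReal.ofReal_one]
  refine (totalVariation_convMeasure_le_translates hΩb T hcont (hρ.compactSupport n hn) μ
    hE).trans ?_
  calc ∫⁻ y, ‖ρ n y‖ₑ * μ.totalVariation {w | w + y ∈ E}
      ≤ ∫⁻ y, ‖ρ n y‖ₑ * ε := by
        refine lintegral_mono fun y => ?_
        by_cases hy : ρ n y = 0
        · simp [hy]
        · have hlt : Real.sqrt (y.1 ^ 2 + ‖y.2‖ ^ 2) < 1 / (n : ℝ) :=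
            hρ.support_subset n hn (subset_tsupport _ hy)
          -- The norm of the product space is the maximum norm, whereas the mollifiers live in
          -- Euclidean balls.
          have hle : ‖y‖ ≤ Real.sqrt (y.1 ^ 2 + ‖y.2‖ ^ 2) := by
            rw [Prod.norm_def]
            refine max_le ?_ ?_
            · rw [Real.norm_eq_abs, ← Real.sqrt_sq_eq_abs]
              exact Real.sqrt_le_sqrt (le_add_of_nonneg_right (sq_nonneg _))
            · exact Real.le_sqrt_of_sq_le (le_add_of_nonneg_left (sq_nonneg _))
          exact mul_le_mul_right (h y (hle.trans_lt hlt)) _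
    _ = ε := by rw [lintegral_mul_const _ hcont.measurable.enorm, hone, one_mul]

theorem exists_convMeasure_le_of_le (hΩb : Bornology.IsBounded Ω) (T : ℝ)
    {ρ : ℕ → SpaceTime N → ℝ} (hρ : IsMollifierSeq ρ) (μ : SignedMeasure (SpaceTime N))
    (n₀ : ℕ) : ∃ C : ℝ≥0∞, C ≠ ⊤ ∧ ∀ n, 1 ≤ n → n ≤ n₀ → ∀ E : Set (SpaceTime N),
      MeasurableSet E → (convMeasure Ω T (ρ n) μ).totalVariation E ≤ C * volume E := by
  choose! C hC hCE using fun n (hn : 1 ≤ n) => exists_totalVariation_convMeasure_le_volume hΩb T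
    (hρ.smooth n hn).continuous (hρ.compactSupport n hn) μ
  refine ⟨∑ n ∈ Finset.Icc 1 n₀, C n, ?_, fun n hn hn₀ E hE => ?_⟩
  · exact (ENNReal.sum_lt_top.2 fun n hn => (hC n (Finset.mem_Icc.1 hn).1).lt_top).ne
  · refine (hCE n hn E hE).trans ?_
    gcongr
    exact Finset.single_le_sum (f := C) (fun _ _ => zero_le) (Finset.mem_Icc.2 ⟨hn, hn₀⟩)

end Equidiffuse

end ParabolicCapacity

end

/-! ### Conclusion: equidiffusion of the mollified measures. -/

theorem mainTheorem12 (N : ℕ) (Ω : Set (EuclideanSpace ℝ (Fin N))) (hΩo : IsOpen Ω)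
    (hΩb : Bornology.IsBounded Ω) (T : ℝ) (hT : 0 < T)
    (p : ENNReal) [Fact (1 ≤ p)] (hp : 1 < p) (hp' : p ≠ ⊤)
    (ρ : ℕ → ℝ × EuclideanSpace ℝ (Fin N) → ℝ) (hρ : ParabolicCapacity.IsMollifierSeq ρ)
    (μ : MeasureTheory.SignedMeasure (ℝ × EuclideanSpace ℝ (Fin N)))
    (hμ : ParabolicCapacity.IsDiffuse Ω p T μ) :
    ParabolicCapacity.IsEquidiffuse Ω p T
      (fun n => ParabolicCapacity.convMeasure Ω T (ρ n) μ) := by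
  intro ε hε
  have hε' : ENNReal.ofReal ε ≠ 0 := by simpa using hε
  have hε2 : ENNReal.ofReal ε / 2 ≠ 0 := by simpa using hε
  obtain ⟨δ, hδ, η₁, hη₁, hlarge⟩ :=
    ParabolicCapacity.exists_translate_measure_lt hΩo hT hμ hε2
  obtain ⟨n₀, hn₀⟩ := exists_nat_one_div_lt hδ
  obtain ⟨C, hC, hsmall⟩ := ParabolicCapacity.exists_convMeasure_le_of_le hΩb T hρ μ n₀
  obtain ⟨C', hC', hvol⟩ := ParabolicCapacity.exists_volume_le_normW (Ω := Ω) (p := p) hΩb T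
  -- The first entry serves $n>n_0$, the second $n\le n_0$; the entry $1$ keeps `r` finite, so that
  -- it comes from a real number.
  set r : ENNReal := min (min η₁ (ENNReal.ofReal ε / (C * C' + 1))) 1
  have hr0 : r ≠ 0 := by
    refine (lt_min (lt_min (pos_iff_ne_zero.2 hη₁) (ENNReal.div_pos hε' ?_)) one_pos).ne'
    exact ENNReal.add_ne_top.2 ⟨ENNReal.mul_ne_top hC hC', ENNReal.one_ne_top⟩
  have hrtop : r ≠ ⊤ := ((min_le_right _ _).trans_lt ENNReal.one_lt_top).ne
  refine ⟨r.toReal, ENNReal.toReal_pos hr0 hrtop, fun E hE hEQ hcap n hn => ?_⟩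
  rw [ENNReal.ofReal_toReal hrtop] at hcap
  obtain ⟨U, hUo, hEU, hUQ, hU⟩ := ParabolicCapacity.exists_open_of_cap_lt hcap
  obtain ⟨u, F, hu, hD, hnorm⟩ := ParabolicCapacity.exists_competitor_of_capOpen_lt hU
  refine (MeasureTheory.measure_mono hEU).trans_lt ?_
  rcases le_or_gt n n₀ with hle | hgt
  · refine (hsmall n hn hle U hUo.measurableSet).trans_lt ?_
    refine (mul_le_mul_right (hvol U hUo.measurableSet hUQ u F hu hD) C).trans_lt ?_
    rw [← mul_assoc]
    exact ParabolicCapacity.mul_lt_of_lt_div_add_one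
      (hnorm.trans_le ((min_le_left _ _).trans (min_le_right _ _)))
  · refine (hρ.totalVariation_convMeasure_le_of_translates hΩb T hn μ hUo.measurableSet
      fun y hy => (hlarge y ?_ U hUo u F hu hD
        (hnorm.trans_le ((min_le_left _ _).trans (min_le_left _ _)))).le).trans_lt
      (ENNReal.half_lt_self hε' ENNReal.ofReal_ne_top)
    -- From $n\ge n_0+1$ follows $1/n\le1/(n_0+1)<\delta$.
    refine hy.trans_le ((one_div_le_one_div_of_le (by positivity) ?_).trans hn₀.le)
    exact_mod_cast hgt
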